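/- Let $d\ge 1$ be an integer, let $\mathbb{D}^d=\{z\in\mathbb{C}^d : |z_i|<1 \text{ for all } i\}$ be the unit polydisc, and let $m$ be the Haar probability measure on the torus $\mathbb{T}^d=\{z\in\mathbb{C}^d:|z_i|=1 \text{ for all } i\}$. For $1\le p<\infty$ the Hardy space $H^p(\mathbb{D}^d)$ consists of the holomorphic functions $f$ on $\mathbb{D}^d$ with $$\|f\|_p^p:=\sup_{0<r<1}\int_{\mathbb{T}^d}|f(rz)|^p\,dm(z)<\infty .$$ A positive Borel measure $\mu$ on $\mathbb{D}^d$ is called a Carleson measure for $H^p(\mathbb{D}^d)$ if $H^p(\mathbb{D}^d)\subseteq L^p(\mathbb{D}^d,\mu)$, that is, if $\int_{\mathbb{D}^d}|f|^p\,d\mu<\infty$ for every $f\in H^p(\mathbb{D}^d)$. Let $1<p<q<\infty$. Then every Carleson measure for $H^p(\mathbb{D}^d)$ is a Carleson measure for $H^q(\mathbb{D}^d)$. -/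

import Mathlib

open MeasureTheory
open scoped ENNReal

/-- The open unit polydisc `𝔻ᵈ` in `ℂᵈ`. -/
def polydisc (d : ℕ) : Set (Fin d → ℂ) := {z | ∀ i, ‖z i‖ < 1}

/-- The point `(e^{2πiθ₁}, …, e^{2πiθ_d})` of the torus `𝕋ᵈ ⊆ ℂᵈ` with angles `θ ∈ (ℝ/ℤ)ᵈ`. -/
noncomputable def torusPoint {d : ℕ} (θ : UnitAddTorus (Fin d)) : Fin d → ℂ :=
  fun i => ((θ i).toCircle : ℂ)

/-- The normalized (probability) Haar measure of `𝕋ᵈ ≅ (ℝ/ℤ)ᵈ`: the product of the normalized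
Haar measures of the circles. -/
noncomputable def torusHaar (d : ℕ) : Measure (UnitAddTorus (Fin d)) :=
  Measure.pi fun _ => (AddCircle.haarAddCircle : Measure UnitAddCircle)

/-- `‖f‖_p ^ p = sup_{0 < r < 1} ∫_{𝕋ᵈ} |f (r z)|^p dm(z)`, as an element of `[0, ∞]`. -/
noncomputable def hardyNormPow {d : ℕ} (p : ℝ) (f : (Fin d → ℂ) → ℂ) : ℝ≥0∞ :=
  ⨆ r ∈ Set.Ioo (0 : ℝ) 1,
    ∫⁻ θ, ‖f ((r : ℂ) • torusPoint θ)‖ₑ ^ p ∂(torusHaar d)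

/-- `f` (that is, its restriction to `𝔻ᵈ`) belongs to the Hardy space `H^p(𝔻ᵈ)`, `0 < p < ∞`:
it is holomorphic in `𝔻ᵈ` and `‖f‖_p < ∞`. Values of `f` outside `𝔻ᵈ` play no role. -/
def MemHardy {d : ℕ} (p : ℝ) (f : (Fin d → ℂ) → ℂ) : Prop :=
  DifferentiableOn ℂ f (polydisc d) ∧ hardyNormPow p f < ∞

/-- A positive Borel measure `μ` on `𝔻ᵈ` is a Carleson measure for `H^p(𝔻ᵈ)` if
`H^p(𝔻ᵈ) ⊆ L^p(𝔻ᵈ, μ)`. (The σ-algebra of the subtype `polydisc d` is its Borel σ-algebra.) -/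
def IsCarlesonMeasure {d : ℕ} (p : ℝ) (μ : Measure (polydisc d)) : Prop :=
  ∀ f : (Fin d → ℂ) → ℂ, MemHardy p f →
    MemLp (fun z : polydisc d => f z) (ENNReal.ofReal p) μ

/-! If `f ∈ H^{np}` with `n` a positive integer, then `f ^ n ∈ H^p`, so a Carleson measure `μ` for
`H^p` is one for every `H^{np}`. The exponents in between are the difficulty: `f ^ (q / p)` need not
be holomorphic when `f` has zeros. They are reached by interpolating an operator defined on all of
`L^s` of the torus rather than on the subspace `H^s`.

That operator is the Cauchy integral. By M. Riesz's theorem (`exists_lintegral_cauchyTorus_rpow_le`)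
it maps `L^s` of the torus into `H^s` for `s > 1`, so for a Carleson measure it maps `L^s` into
`L^s(μ)`, boundedly by the closed graph theorem. With `n p > q`, Marcinkiewicz interpolation between
`s = p` and `s = n p` bounds it from `L^q` to `L^q(μ)`. For `f ∈ H^q` each dilate `f(r ·)` is the
Cauchy integral of its values on the torus, so its `L^q(μ)` norm is bounded uniformly in `r`;
Fatou's lemma as `r → 1` finishes.

Riesz's theorem on the circle reduces to `h ≥ 0`. Then the Cauchy integral `F` of `h` takes values
in the right half-plane (unless `h = 0` a.e.), `F ^ p` is holomorphic, and its mean over a circle is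
`F(0) ^ p`. The inequality `|z| ^ p ≤ A (Re z) ^ p + B Re (z ^ p)` on the half-plane gives the bound
whenever `cos (p π / 2) ≠ 0`; the excluded odd integers follow by interpolating between neighbouring
exponents. The polydisc follows one variable at a time by Fubini. -/

/-! ### The Szegő kernel and Cauchy's formula on the disc -/

/-- The Szegő kernel `1 / (1 - z conj(e^{2πiθ}))` of the unit disc. -/
noncomputable def szego (z : ℂ) (θ : UnitAddCircle) : ℂ :=
  (1 - z * starRingEnd ℂ (θ.toCircle : ℂ))⁻¹

lemma norm_mul_conj_toCircle (z : ℂ) (θ : UnitAddCircle) :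
    ‖z * starRingEnd ℂ (θ.toCircle : ℂ)‖ = ‖z‖ := by
  rw [norm_mul, RCLike.norm_conj, Circle.norm_coe, mul_one]

lemma one_sub_mul_conj_toCircle_ne_zero {z : ℂ} (hz : ‖z‖ < 1) (θ : UnitAddCircle) :
    1 - z * starRingEnd ℂ (θ.toCircle : ℂ) ≠ 0 := by
  intro h
  have h1 : ‖z * starRingEnd ℂ (θ.toCircle : ℂ)‖ = 1 := by rw [← sub_eq_zero.1 h]; simp
  rw [norm_mul_conj_toCircle] at h1
  exact hz.ne h1

lemma continuous_coe_toCircle : Continuous fun θ : UnitAddCircle => (θ.toCircle : ℂ) :=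
  continuous_subtype_val.comp AddCircle.continuous_toCircle

lemma continuous_szego {z : ℂ} (hz : ‖z‖ < 1) : Continuous (szego z) := by
  unfold szego
  refine Continuous.inv₀ ?_ (one_sub_mul_conj_toCircle_ne_zero hz)
  have := continuous_coe_toCircle
  fun_prop

/-- `w ↦ 1 / (1 - w)` maps the unit disc onto the half-plane `Re > 1/2`. Positivity of this real
part lets it play the role of the Poisson kernel. -/
lemma half_le_re_szego {z : ℂ} (hz : ‖z‖ < 1) (θ : UnitAddCircle) : 1 / 2 ≤ (szego z θ).re := by
  unfold szego
  set w := z * starRingEnd ℂ (θ.toCircle : ℂ) with hw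
  have hw1 : ‖w‖ < 1 := by rw [hw, norm_mul_conj_toCircle]; exact hz
  have hne : 1 - w ≠ 0 := one_sub_mul_conj_toCircle_ne_zero hz θ
  rw [Complex.inv_re, div_le_div_iff₀ two_pos (Complex.normSq_pos.2 hne)]
  have h2 : Complex.normSq w < 1 := by
    rw [Complex.normSq_eq_norm_sq]; nlinarith [norm_nonneg w]
  rw [Complex.normSq_apply] at h2 ⊢
  simp only [Complex.sub_re, Complex.one_re, Complex.sub_im, Complex.one_im]
  nlinarith

/-- Exchanging the two angles conjugates the kernel. Hence its real part has total mass one in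
either angle. -/
lemma szego_symm (r : ℝ) (φ θ : UnitAddCircle) :
    (szego (r * (φ.toCircle : ℂ)) θ).re = (szego (r * (θ.toCircle : ℂ)) φ).re := by
  have : szego (r * (φ.toCircle : ℂ)) θ = starRingEnd ℂ (szego (r * (θ.toCircle : ℂ)) φ) := by
    unfold szego
    simp only [map_inv₀, map_sub, map_one, map_mul, Complex.conj_ofReal, Complex.conj_conj]
    ring_nf
  rw [this, Complex.conj_re]

lemma integral_toCircle_eq_circleAverage (h : ℂ → ℂ) :
    ∫ θ : UnitAddCircle, h (θ.toCircle : ℂ) ∂AddCircle.haarAddCircle =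
      Real.circleAverage h 0 1 := by
  rw [AddCircle.integral_haarAddCircle, ← UnitAddCircle.intervalIntegral_preimage 0]
  rw [Real.circleAverage_def]
  have h1 : ∀ a : ℝ, h (AddCircle.toCircle (a : UnitAddCircle) : ℂ) =
      (fun x => h (circleMap 0 1 x)) (2 * Real.pi * a) := by
    intro a
    rw [AddCircle.toCircle_apply_mk]
    simp [circleMap, Circle.coe_exp]
  rw [intervalIntegral.integral_congr fun a _ => h1 a]
  rw [intervalIntegral.integral_comp_mul_left (fun x => h (circleMap 0 1 x))
    (by positivity : 2 * Real.pi ≠ 0)]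
  simp

/-- Cauchy's integral formula for the unit disc. -/
lemma integral_szego_mul {f : ℂ → ℂ} (hf : DiffContOnCl ℂ f (Metric.ball 0 1)) {z : ℂ}
    (hz : ‖z‖ < 1) :
    ∫ θ : UnitAddCircle, szego z θ * f (θ.toCircle : ℂ) ∂AddCircle.haarAddCircle = f z := by
  have hf' : DiffContOnCl ℂ f (Metric.ball 0 |1|) := by simpa using hf
  have h1 := hf'.circleAverage_smul_div (w := z) (by simpa using hz)
  rw [← h1, ← integral_toCircle_eq_circleAverage]
  refine integral_congr_ae (Filter.Eventually.of_forall fun θ => ?_)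
  have h3 : (θ.toCircle : ℂ) ≠ 0 := by simp
  have h2 : starRingEnd ℂ (θ.toCircle : ℂ) = (θ.toCircle : ℂ)⁻¹ := by
    rw [← Circle.coe_inv_eq_conj, Circle.coe_inv]
  simp only [szego, h2, sub_zero, smul_eq_mul]
  congr 1
  rw [← div_eq_mul_inv, one_sub_div h3, inv_div]

lemma integral_re_szego {z : ℂ} (hz : ‖z‖ < 1) :
    ∫ θ : UnitAddCircle, (szego z θ).re ∂AddCircle.haarAddCircle = 1 := by
  have h := integral_szego_mul (f := fun _ => 1) diffContOnCl_const hz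
  simp only [mul_one] at h
  have h1 : Integrable (szego z) (AddCircle.haarAddCircle : Measure UnitAddCircle) :=
    (continuous_szego hz).integrable_of_hasCompactSupport (HasCompactSupport.of_compactSpace _)
  have h2 := integral_re (𝕜 := ℂ) h1
  simp only [RCLike.re_to_complex] at h2
  rw [h2, h, Complex.one_re]

/-! ### Holomorphy of Cauchy integrals -/

/-- Integrating a holomorphic family of continuous functions against an integrable function
gives a holomorphic function. -/
lemma DifferentiableOn.integral_continuousMap_mul {X E : Type*} [TopologicalSpace X]
    [CompactSpace X] [MeasurableSpace X] [OpensMeasurableSpace X]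
    [NormedAddCommGroup E] [NormedSpace ℂ E] {ν : Measure X} {g : X → ℂ} (hg : Integrable g ν)
    {s : Set E} {κ : E → C(X, ℂ)} (hκ : DifferentiableOn ℂ κ s) :
    DifferentiableOn ℂ (fun z => ∫ x, κ z x * g x ∂ν) s := by
  have hint : ∀ h : C(X, ℂ), Integrable (fun x => h x * g x) ν := fun h =>
    hg.bdd_mul h.continuous.aestronglyMeasurable
      (Filter.Eventually.of_forall fun x => h.norm_coe_le_norm x)
  -- Integration against `g` is a bounded linear functional on `C(X, ℂ)`, so composing with it
  -- preserves holomorphy and no differentiation under the integral is needed.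
  let L : C(X, ℂ) →ₗ[ℂ] ℂ :=
    { toFun := fun h => ∫ x, h x * g x ∂ν
      map_add' := fun h₁ h₂ => by
        rw [← integral_add (hint h₁) (hint h₂)]
        simp [add_mul]
      map_smul' := fun c h => by
        simp [mul_assoc, integral_const_mul] }
  let L' : C(X, ℂ) →L[ℂ] ℂ := L.mkContinuous (∫ x, ‖g x‖ ∂ν) fun h => by
    change ‖∫ x, h x * g x ∂ν‖ ≤ _
    rw [mul_comm, ← integral_const_mul]
    refine norm_integral_le_of_norm_le (hg.norm.const_mul _) (Filter.Eventually.of_forall fun x => ?_)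
    rw [norm_mul]
    gcongr
    exact h.norm_coe_le_norm x
  exact L'.differentiable.comp_differentiableOn hκ

lemma isUnit_continuousMap {X : Type*} [TopologicalSpace X] {h : C(X, ℂ)} (hh : ∀ x, h x ≠ 0) :
    IsUnit h := by
  refine IsUnit.of_mul_eq_one ⟨fun x => (h x)⁻¹, h.continuous.inv₀ hh⟩ ?_
  ext x
  simp [hh x]

lemma ringInverse_continuousMap_apply {X : Type*} [TopologicalSpace X] {h : C(X, ℂ)}
    (hh : ∀ x, h x ≠ 0) (x : X) : Ring.inverse h x = (h x)⁻¹ := by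
  have h1 := congrArg (fun k : C(X, ℂ) => k x) (Ring.mul_inverse_cancel h (isUnit_continuousMap hh))
  exact eq_inv_of_mul_eq_one_right (by simpa using h1)

/-- The product Szegő kernel of the polydisc. -/
noncomputable def szegoPi {d : ℕ} (z : Fin d → ℂ) (θ : UnitAddTorus (Fin d)) : ℂ :=
  ∏ i, szego (z i) (θ i)

/-- The Cauchy integral of a function on the torus. -/
noncomputable def cauchyTorus {d : ℕ} (g : UnitAddTorus (Fin d) → ℂ) (z : Fin d → ℂ) : ℂ :=
  ∫ θ, szegoPi z θ * g θ ∂(torusHaar d)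

/-- The Cauchy integral of a function on the circle. -/
noncomputable def cauchyCircle (g : UnitAddCircle → ℂ) (z : ℂ) : ℂ :=
  ∫ θ, szego z θ * g θ ∂AddCircle.haarAddCircle

lemma differentiableOn_cauchyTorus {d : ℕ} {g : UnitAddTorus (Fin d) → ℂ}
    (hg : Integrable g (torusHaar d)) : DifferentiableOn ℂ (cauchyTorus g) (polydisc d) := by
  let c : Fin d → C(UnitAddTorus (Fin d), ℂ) := fun i =>
    ⟨fun θ => starRingEnd ℂ ((θ i).toCircle : ℂ), by
      have := continuous_coe_toCircle
      fun_prop⟩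
  -- The kernel as a map into the Banach algebra of continuous functions on the torus, where
  -- inversion is differentiable at units.
  let κ : (Fin d → ℂ) → C(UnitAddTorus (Fin d), ℂ) := fun z =>
    ∏ i, Ring.inverse (1 - z i • c i)
  have hne : ∀ z ∈ polydisc d, ∀ i θ, (1 - z i • c i) θ ≠ 0 := fun z hz i θ =>
    one_sub_mul_conj_toCircle_ne_zero (hz i) (θ i)
  have hκ : DifferentiableOn ℂ κ (polydisc d) := by
    have h1 : ∀ i, DifferentiableOn ℂ (fun z : Fin d → ℂ => Ring.inverse (1 - z i • c i))
        (polydisc d) := fun i =>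
      DifferentiableOn.inverse (by fun_prop) fun z hz => isUnit_continuousMap (hne z hz i)
    have h2 : ∀ s : Finset (Fin d), DifferentiableOn ℂ
        (fun z : Fin d → ℂ => ∏ i ∈ s, Ring.inverse (1 - z i • c i)) (polydisc d) := by
      intro s
      induction s using Finset.cons_induction with
      | empty => simp
      | cons a s ha ih =>
        simp only [Finset.prod_cons]
        exact (h1 a).mul ih
    exact h2 Finset.univ
  refine (hκ.integral_continuousMap_mul hg).congr fun z hz => ?_
  refine integral_congr_ae (Filter.Eventually.of_forall fun θ => ?_)
  simp only [κ, szegoPi, ContinuousMap.coe_prod, Finset.prod_apply]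
  congr 1
  refine Finset.prod_congr rfl fun i _ => ?_
  rw [ringInverse_continuousMap_apply (hne z hz i)]
  rfl

lemma differentiableOn_cauchyCircle {g : UnitAddCircle → ℂ}
    (hg : Integrable g AddCircle.haarAddCircle) :
    DifferentiableOn ℂ (cauchyCircle g) (Metric.ball 0 1) := by
  let c : C(UnitAddCircle, ℂ) :=
    ⟨fun θ => starRingEnd ℂ (θ.toCircle : ℂ), by
      have := continuous_coe_toCircle
      fun_prop⟩
  let κ : ℂ → C(UnitAddCircle, ℂ) := fun z => Ring.inverse (1 - z • c)
  have hne : ∀ z ∈ Metric.ball (0 : ℂ) 1, ∀ θ, (1 - z • c) θ ≠ 0 := fun z hz θ =>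
    one_sub_mul_conj_toCircle_ne_zero (by simpa using hz) θ
  have hκ : DifferentiableOn ℂ κ (Metric.ball 0 1) :=
    DifferentiableOn.inverse (by fun_prop) fun z hz => isUnit_continuousMap (hne z hz)
  refine (hκ.integral_continuousMap_mul hg).congr fun z hz => ?_
  refine integral_congr_ae (Filter.Eventually.of_forall fun θ => ?_)
  simp only [κ]
  rw [ringInverse_continuousMap_apply (hne z hz)]
  rfl

/-! ### Marcinkiewicz interpolation -/

lemma lintegral_Ioi_zero_indicator_Iio_rpow {s a : ℝ} (hs : 0 < s) (ha : 0 ≤ a) :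
    ∫⁻ t in Set.Ioi (0 : ℝ), (Set.Iio a).indicator (fun t => ENNReal.ofReal (t ^ (s - 1))) t =
      ENNReal.ofReal (a ^ s / s) := by
  rw [lintegral_indicator measurableSet_Iio, Measure.restrict_restrict measurableSet_Iio,
    Set.inter_comm, Set.Ioi_inter_Iio, restrict_Ioo_eq_restrict_Ioc]
  have hint : IntervalIntegrable (fun t : ℝ => t ^ (s - 1)) volume 0 a :=
    intervalIntegral.intervalIntegrable_rpow' (by linarith)
  rw [← ofReal_integral_eq_lintegral_ofReal, ← intervalIntegral.integral_of_le ha,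
    integral_rpow (Or.inl (by linarith))]
  · simp [hs.ne']
  · exact (intervalIntegrable_iff_integrableOn_Ioc_of_le ha).1 hint
  · filter_upwards [ae_restrict_mem measurableSet_Ioc] with t ht
    exact Real.rpow_nonneg ht.1.le _

lemma lintegral_Ioi_zero_indicator_Ici_rpow {s a : ℝ} (hs : 0 < s) (ha : 0 < a) :
    ∫⁻ t in Set.Ioi (0 : ℝ), (Set.Ici a).indicator (fun t => ENNReal.ofReal (t ^ (-s - 1))) t =
      ENNReal.ofReal (a ^ (-s) / s) := by
  rw [lintegral_indicator measurableSet_Ici, Measure.restrict_restrict measurableSet_Ici,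
    Set.inter_eq_left.2 (Set.Ici_subset_Ioi.2 ha), ← setLIntegral_congr Ioi_ae_eq_Ici]
  rw [← ofReal_integral_eq_lintegral_ofReal, integral_Ioi_rpow_of_lt (by linarith) ha]
  · congr 1
    rw [sub_add_cancel, neg_div_neg_eq]
  · exact integrableOn_Ioi_rpow_of_lt (by linarith) ha
  · filter_upwards [ae_restrict_mem measurableSet_Ioi] with t ht
    exact Real.rpow_nonneg (ha.trans ht).le _

/-- Chebyshev's inequality at level `t / 2`, the share of `t` left to each half of a split function.
-/
lemma meas_half_le_enorm_le {Y : Type*} [MeasurableSpace Y] {μ : Measure Y} {u : Y → ℂ}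
    (hu : AEMeasurable u μ) {p t : ℝ} (hp : 0 < p) (ht : 0 < t) :
    μ {y | t / 2 ≤ ‖u y‖} ≤ ENNReal.ofReal (2 ^ p * t ^ (-p)) * ∫⁻ y, ‖u y‖ₑ ^ p ∂μ := by
  have h1 : {y | t / 2 ≤ ‖u y‖} ⊆ {y | ENNReal.ofReal ((t / 2) ^ p) ≤ ‖u y‖ₑ ^ p} := by
    intro y hy
    simp only [Set.mem_ofPred_eq] at hy ⊢
    rw [← ofReal_norm, ENNReal.ofReal_rpow_of_nonneg (norm_nonneg _) hp.le]
    exact ENNReal.ofReal_le_ofReal (Real.rpow_le_rpow (by positivity) hy hp.le)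
  have hpos : 0 < (t / 2) ^ p := by positivity
  refine (measure_mono h1).trans ((meas_ge_le_lintegral_div (hu.enorm.pow_const p)
    (by simpa using hpos) ENNReal.ofReal_ne_top).trans (le_of_eq ?_))
  rw [ENNReal.div_eq_inv_mul, ← ENNReal.ofReal_inv_of_pos hpos, Real.div_rpow ht.le (by norm_num),
    inv_div, Real.rpow_neg ht.le, div_eq_mul_inv]

/-- **Marcinkiewicz interpolation** between two strong-type bounds. -/
theorem lintegral_enorm_rpow_le_of_strong_type {X Y : Type*} [MeasurableSpace X]
    [MeasurableSpace Y] {ν : Measure X} [SFinite ν] {μ : Measure Y} (T : (X → ℂ) → Y → ℂ)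
    {p₀ q p₁ : ℝ} (hp₀ : 0 < p₀) (hq₀ : p₀ < q) (hq₁ : q < p₁) {A B : ℝ≥0∞}
    (hadd : ∀ g h, Measurable g → Measurable h → Integrable g ν → Integrable h ν →
      ∀ y, ‖T (g + h) y‖ ≤ ‖T g y‖ + ‖T h y‖)
    (hm : ∀ g, Measurable g → Integrable g ν → AEMeasurable (T g) μ)
    (hA : ∀ g, Measurable g → Integrable g ν →
      ∫⁻ y, ‖T g y‖ₑ ^ p₀ ∂μ ≤ A * ∫⁻ x, ‖g x‖ₑ ^ p₀ ∂ν)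
    (hB : ∀ g, Measurable g → Integrable g ν →
      ∫⁻ y, ‖T g y‖ₑ ^ p₁ ∂μ ≤ B * ∫⁻ x, ‖g x‖ₑ ^ p₁ ∂ν)
    {g : X → ℂ} (hg : Measurable g) (hgi : Integrable g ν) :
    ∫⁻ y, ‖T g y‖ₑ ^ q ∂μ ≤
      ENNReal.ofReal q * (ENNReal.ofReal (2 ^ p₀) * A * ENNReal.ofReal (1 / (q - p₀)) +
        ENNReal.ofReal (2 ^ p₁) * B * ENNReal.ofReal (1 / (p₁ - q))) * ∫⁻ x, ‖g x‖ₑ ^ q ∂ν := by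
  have hq : 0 < q := hp₀.trans hq₀
  have hp₁ : 0 < p₁ := hq.trans hq₁
  -- The layer-cake formula requires no σ-finiteness of `μ`; Tonelli is used only for `ν` and `dt`.
  have hlayer := lintegral_rpow_eq_lintegral_meas_lt_mul μ (f := fun y => ‖T g y‖)
    (Filter.Eventually.of_forall fun y => norm_nonneg _) (hm g hg hgi).norm hq
  have hl : ∫⁻ y, ‖T g y‖ₑ ^ q ∂μ = ∫⁻ y, ENNReal.ofReal (‖T g y‖ ^ q) ∂μ := by
    refine lintegral_congr fun y => ?_
    rw [← ofReal_norm, ENNReal.ofReal_rpow_of_nonneg (norm_nonneg _) hq.le]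
  rw [hl, hlayer, mul_assoc (ENNReal.ofReal q)]
  gcongr
  -- Integrands in `(t, x)` left after Chebyshev: `a₀` from the part of `g` above height `t`,
  -- estimated with `p₀`, and `a₁` from the part below, estimated with `p₁`.
  let a₀ : ℝ → X → ℝ≥0∞ := fun t x => (Set.Iio ‖g x‖).indicator
    (fun t => ENNReal.ofReal (t ^ (q - p₀ - 1))) t * ‖g x‖ₑ ^ p₀
  let a₁ : ℝ → X → ℝ≥0∞ := fun t x => (Set.Ici ‖g x‖).indicator
    (fun t => ENNReal.ofReal (t ^ (-(p₁ - q) - 1))) t * ‖g x‖ₑ ^ p₁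
  have hpow₀ : Measurable fun x => ‖g x‖ₑ ^ p₀ := hg.enorm.pow_const _
  have hpow₁ : Measurable fun x => ‖g x‖ₑ ^ p₁ := hg.enorm.pow_const _
  have hma₀ : Measurable (Function.uncurry a₀) := by
    refine Measurable.mul ?_ (hpow₀.comp measurable_snd)
    have h1 : MeasurableSet {z : ℝ × X | z.1 < ‖g z.2‖} :=
      measurableSet_lt measurable_fst (hg.comp measurable_snd).norm
    have h2 : Measurable fun z : ℝ × X => ENNReal.ofReal (z.1 ^ (q - p₀ - 1)) := by fun_prop
    exact h2.indicator h1
  have hma₁ : Measurable (Function.uncurry a₁) := by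
    refine Measurable.mul ?_ (hpow₁.comp measurable_snd)
    have h1 : MeasurableSet {z : ℝ × X | ‖g z.2‖ ≤ z.1} :=
      measurableSet_le (hg.comp measurable_snd).norm measurable_fst
    have h2 : Measurable fun z : ℝ × X => ENNReal.ofReal (z.1 ^ (-(p₁ - q) - 1)) := by fun_prop
    exact h2.indicator h1
  have hkey : ∀ t ∈ Set.Ioi (0 : ℝ), μ {y | t < ‖T g y‖} * ENNReal.ofReal (t ^ (q - 1)) ≤
      ENNReal.ofReal (2 ^ p₀) * A * (∫⁻ x, a₀ t x ∂ν) +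
        ENNReal.ofReal (2 ^ p₁) * B * (∫⁻ x, a₁ t x ∂ν) := by
    intro t ht
    have ht' : (0 : ℝ) < t := ht
    -- Cut `g` at height `t`. Both pieces remain integrable, and where `|T g| > t` at least one
    -- image is `≥ t / 2`.
    let S : Set X := {x | t < ‖g x‖}
    have hS : MeasurableSet S := measurableSet_lt measurable_const hg.norm
    have hsplit : S.indicator g + Sᶜ.indicator g = g := Set.indicator_self_add_compl S g
    have hsub : {y | t < ‖T g y‖} ⊆
        {y | t / 2 ≤ ‖T (S.indicator g) y‖} ∪ {y | t / 2 ≤ ‖T (Sᶜ.indicator g) y‖} := by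
      intro y hy
      have h1 := hadd _ _ (hg.indicator hS) (hg.indicator hS.compl) (hgi.indicator hS)
        (hgi.indicator hS.compl) y
      rw [hsplit] at h1
      simp only [Set.mem_ofPred_eq, Set.mem_union] at hy ⊢
      by_contra! h2
      linarith [h2.1, h2.2]
    have h₀ : μ {y | t / 2 ≤ ‖T (S.indicator g) y‖} * ENNReal.ofReal (t ^ (q - 1)) ≤
        ENNReal.ofReal (2 ^ p₀) * A * (∫⁻ x, a₀ t x ∂ν) := by
      refine (mul_le_mul_left ((meas_half_le_enorm_le (hm _ (hg.indicator hS)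
        (hgi.indicator hS)) hp₀ ht').trans (mul_le_mul_right (hA _ (hg.indicator hS)
        (hgi.indicator hS)) _)) _).trans (le_of_eq ?_)
      have h3 : ∫⁻ x, a₀ t x ∂ν =
          ENNReal.ofReal (t ^ (q - p₀ - 1)) * ∫⁻ x, ‖S.indicator g x‖ₑ ^ p₀ ∂ν := by
        rw [← lintegral_const_mul _ ((hg.indicator hS).enorm.pow_const _)]
        refine lintegral_congr fun x => ?_
        by_cases hx : t < ‖g x‖
        · simp [a₀, S, hx]
        · simp [a₀, S, hx, hp₀]
      rw [h3, ENNReal.ofReal_mul (by positivity)]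
      have h4 : t ^ (q - p₀ - 1) = t ^ (-p₀) * t ^ (q - 1) := by
        rw [← Real.rpow_add ht']; ring_nf
      rw [h4, ENNReal.ofReal_mul (by positivity)]
      ring
    have h₁ : μ {y | t / 2 ≤ ‖T (Sᶜ.indicator g) y‖} * ENNReal.ofReal (t ^ (q - 1)) ≤
        ENNReal.ofReal (2 ^ p₁) * B * (∫⁻ x, a₁ t x ∂ν) := by
      refine (mul_le_mul_left ((meas_half_le_enorm_le (hm _ (hg.indicator hS.compl)
        (hgi.indicator hS.compl)) hp₁ ht').trans (mul_le_mul_right (hB _ (hg.indicator hS.compl)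
        (hgi.indicator hS.compl)) _)) _).trans (le_of_eq ?_)
      have h3 : ∫⁻ x, a₁ t x ∂ν =
          ENNReal.ofReal (t ^ (-(p₁ - q) - 1)) * ∫⁻ x, ‖Sᶜ.indicator g x‖ₑ ^ p₁ ∂ν := by
        rw [← lintegral_const_mul _ ((hg.indicator hS.compl).enorm.pow_const _)]
        refine lintegral_congr fun x => ?_
        by_cases hx : t < ‖g x‖
        · simp [a₁, S, hx, hp₁]
        · simp [a₁, S, hx, not_lt.1 hx]
      rw [h3, ENNReal.ofReal_mul (by positivity)]
      have h4 : t ^ (-(p₁ - q) - 1) = t ^ (-p₁) * t ^ (q - 1) := by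
        rw [← Real.rpow_add ht']; ring_nf
      rw [h4, ENNReal.ofReal_mul (by positivity)]
      ring
    calc μ {y | t < ‖T g y‖} * ENNReal.ofReal (t ^ (q - 1))
        ≤ (μ {y | t / 2 ≤ ‖T (S.indicator g) y‖} + μ {y | t / 2 ≤ ‖T (Sᶜ.indicator g) y‖}) *
            ENNReal.ofReal (t ^ (q - 1)) := by
          gcongr
          exact (measure_mono hsub).trans (measure_union_le _ _)
      _ ≤ _ := by
          rw [add_mul]
          exact add_le_add h₀ h₁
  have hI₀ : ∀ x, ∫⁻ t in Set.Ioi (0 : ℝ), a₀ t x =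
      ENNReal.ofReal (1 / (q - p₀)) * ‖g x‖ₑ ^ q := by
    intro x
    simp only [a₀]
    rw [lintegral_mul_const _ ((by fun_prop : Measurable fun t : ℝ =>
      ENNReal.ofReal (t ^ (q - p₀ - 1))).indicator measurableSet_Iio),
      lintegral_Ioi_zero_indicator_Iio_rpow (sub_pos.2 hq₀) (norm_nonneg _)]
    rw [← ofReal_norm, ENNReal.ofReal_rpow_of_nonneg (norm_nonneg _) hp₀.le,
      ENNReal.ofReal_rpow_of_nonneg (norm_nonneg _) hq.le, ← ENNReal.ofReal_mul (by
        have := sub_pos.2 hq₀; positivity), ← ENNReal.ofReal_mul (by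
        have := sub_pos.2 hq₀; positivity)]
    congr 1
    have h5 : ‖g x‖ ^ q = ‖g x‖ ^ (q - p₀) * ‖g x‖ ^ p₀ := by
      rw [← Real.rpow_add_of_nonneg (norm_nonneg _) (sub_pos.2 hq₀).le hp₀.le]; ring_nf
    rw [h5]; ring
  have hI₁ : ∀ x, ∫⁻ t in Set.Ioi (0 : ℝ), a₁ t x ≤
      ENNReal.ofReal (1 / (p₁ - q)) * ‖g x‖ₑ ^ q := by
    intro x
    -- At a zero of `g` the weight `t ^ (-(p₁ - q) - 1)` is not integrable down to `0`, but the
    -- factor `‖g x‖ₑ ^ p₁` vanishes; hence only `≤` is claimed.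
    rcases eq_or_ne (g x) 0 with h0 | h0
    · simp [a₁, h0, hp₁]
    have hgx : 0 < ‖g x‖ := norm_pos_iff.2 h0
    simp only [a₁]
    rw [lintegral_mul_const _ ((by fun_prop : Measurable fun t : ℝ =>
      ENNReal.ofReal (t ^ (-(p₁ - q) - 1))).indicator measurableSet_Ici),
      lintegral_Ioi_zero_indicator_Ici_rpow (sub_pos.2 hq₁) hgx]
    rw [← ofReal_norm, ENNReal.ofReal_rpow_of_nonneg (norm_nonneg _) hp₁.le,
      ENNReal.ofReal_rpow_of_nonneg (norm_nonneg _) hq.le, ← ENNReal.ofReal_mul (by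
        have := sub_pos.2 hq₁; positivity), ← ENNReal.ofReal_mul (by
        have := sub_pos.2 hq₁; positivity)]
    refine le_of_eq ?_
    congr 1
    have h5 : ‖g x‖ ^ q = ‖g x‖ ^ (-(p₁ - q)) * ‖g x‖ ^ p₁ := by
      rw [← Real.rpow_add hgx]; ring_nf
    rw [h5]; ring
  calc ∫⁻ t in Set.Ioi (0 : ℝ), μ {y | t < ‖T g y‖} * ENNReal.ofReal (t ^ (q - 1))
      ≤ ∫⁻ t in Set.Ioi (0 : ℝ), (ENNReal.ofReal (2 ^ p₀) * A * (∫⁻ x, a₀ t x ∂ν) +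
        ENNReal.ofReal (2 ^ p₁) * B * (∫⁻ x, a₁ t x ∂ν)) :=
        setLIntegral_mono' measurableSet_Ioi hkey
    _ = ENNReal.ofReal (2 ^ p₀) * A * (∫⁻ x, ∫⁻ t in Set.Ioi (0 : ℝ), a₀ t x ∂volume ∂ν) +
        ENNReal.ofReal (2 ^ p₁) * B * (∫⁻ x, ∫⁻ t in Set.Ioi (0 : ℝ), a₁ t x ∂volume ∂ν) := by
        have hJ₀ : Measurable fun t => ∫⁻ x, a₀ t x ∂ν := hma₀.lintegral_prod_right'
        have hJ₁ : Measurable fun t => ∫⁻ x, a₁ t x ∂ν := hma₁.lintegral_prod_right'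
        rw [lintegral_add_left (hJ₀.const_mul _), lintegral_const_mul _ hJ₀,
          lintegral_const_mul _ hJ₁,
          lintegral_lintegral_swap hma₀.aemeasurable, lintegral_lintegral_swap hma₁.aemeasurable]
    _ ≤ ENNReal.ofReal (2 ^ p₀) * A * (∫⁻ x, ENNReal.ofReal (1 / (q - p₀)) * ‖g x‖ₑ ^ q ∂ν) +
        ENNReal.ofReal (2 ^ p₁) * B * (∫⁻ x, ENNReal.ofReal (1 / (p₁ - q)) * ‖g x‖ₑ ^ q ∂ν) := by
        gcongr with x x
        · exact (hI₀ x).le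
        · exact hI₁ x
    _ = _ := by
        rw [lintegral_const_mul _ (hg.enorm.pow_const _),
          lintegral_const_mul _ (hg.enorm.pow_const _)]
        ring

/-! ### M. Riesz's theorem on the circle -/

/-- Near `±π/2` the first term may vanish, but `cos (θ p)` is close to `cos (p π / 2) ≠ 0`, so a
suitable `B` of the same sign suffices. Elsewhere `cos θ` is bounded below and a large `A` absorbs
the second term. -/
lemma exists_one_le_cos_rpow_add_cos {p : ℝ} (hp : 0 < p) (hcos : Real.cos (p * (Real.pi / 2)) ≠ 0) :
    ∃ A B : ℝ, 0 ≤ A ∧ ∀ θ : ℝ, |θ| < Real.pi / 2 →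
      1 ≤ A * Real.cos θ ^ p + B * Real.cos (θ * p) := by
  set c := Real.cos (p * (Real.pi / 2)) with hc
  have hc' : 0 < |c| := abs_pos.2 hcos
  have hc1 : |c| ≤ 1 := Real.abs_cos_le_one _
  -- `B cos (θ p)` equals `2` at the endpoint, and `δ` is small enough that it drops by at most `1`
  -- within distance `δ` of it.
  set B := 2 / c with hB
  set δ := min (|c| / (2 * p)) (Real.pi / 4) with hδ
  have hδ0 : 0 < δ := lt_min (by positivity) (by positivity)
  have hδ1 : δ ≤ Real.pi / 4 := min_le_right _ _
  have hδ2 : p * δ ≤ |c| / 2 := by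
    calc p * δ ≤ p * (|c| / (2 * p)) := by gcongr; exact min_le_left _ _
      _ = |c| / 2 := by field_simp
  have hpi := Real.pi_pos
  have hsin : 0 < Real.sin δ := Real.sin_pos_of_pos_of_lt_pi hδ0 (by linarith)
  have hsp : 0 < Real.sin δ ^ p := Real.rpow_pos_of_pos hsin p
  refine ⟨(1 + |B|) / Real.sin δ ^ p, B, by positivity, ?_⟩
  have hmain : ∀ θ : ℝ, 0 ≤ θ → θ < Real.pi / 2 →
      1 ≤ (1 + |B|) / Real.sin δ ^ p * Real.cos θ ^ p + B * Real.cos (θ * p) := by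
    intro θ h0 h1
    have hcosθ : 0 ≤ Real.cos θ := Real.cos_nonneg_of_neg_pi_div_two_le_of_le (by linarith) h1.le
    rcases le_or_gt (Real.pi / 2 - δ) θ with h2 | h2
    · have h3 : 0 ≤ (1 + |B|) / Real.sin δ ^ p * Real.cos θ ^ p := by positivity
      have h4 : |Real.cos (θ * p) - c| ≤ |c| / 2 := by
        calc |Real.cos (θ * p) - c| ≤ |θ * p - p * (Real.pi / 2)| := by
              rw [hc]; exact Real.abs_cos_sub_cos_le _ _
          _ = p * (Real.pi / 2 - θ) := by
              rw [show θ * p - p * (Real.pi / 2) = -(p * (Real.pi / 2 - θ)) by ring, abs_neg,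
                abs_of_nonneg (mul_nonneg hp.le (by linarith))]
          _ ≤ p * δ := by gcongr; linarith
          _ ≤ _ := hδ2
      have h5 : B * Real.cos (θ * p) = 2 + B * (Real.cos (θ * p) - c) := by
        rw [hB]; field_simp; ring
      have h6 : |B * (Real.cos (θ * p) - c)| ≤ 1 := by
        rw [abs_mul, hB, abs_div, abs_two]
        calc 2 / |c| * |Real.cos (θ * p) - c| ≤ 2 / |c| * (|c| / 2) := by gcongr
          _ = 1 := by field_simp
      have h7 := (abs_le.1 h6).1
      linarith
    · have h3 : Real.sin δ ≤ Real.cos θ := by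
        rw [← Real.cos_pi_div_two_sub]
        exact Real.cos_le_cos_of_nonneg_of_le_pi h0 (by linarith) h2.le
      have h4 : 1 + |B| ≤ (1 + |B|) / Real.sin δ ^ p * Real.cos θ ^ p := by
        rw [div_mul_eq_mul_div, le_div_iff₀ hsp]
        gcongr
      have h5 : |B * Real.cos (θ * p)| ≤ |B| := by
        rw [abs_mul]
        exact mul_le_of_le_one_right (abs_nonneg _) (Real.abs_cos_le_one _)
      have h6 := (abs_le.1 h5).1
      linarith
  intro θ hθ
  have h := hmain |θ| (abs_nonneg _) hθ
  rwa [Real.cos_abs, ← abs_of_pos hp, ← abs_mul, Real.cos_abs, abs_of_pos hp] at h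

/-- The trigonometric inequality at `θ = arg z`, scaled by `‖z‖ ^ p`. -/
lemma exists_norm_rpow_le_re_rpow_add_re_cpow {p : ℝ} (hp : 0 < p)
    (hcos : Real.cos (p * (Real.pi / 2)) ≠ 0) :
    ∃ A B : ℝ, 0 ≤ A ∧ ∀ z : ℂ, 0 < z.re → ‖z‖ ^ p ≤ A * z.re ^ p + B * (z ^ (p : ℂ)).re := by
  obtain ⟨A, B, hA, h⟩ := exists_one_le_cos_rpow_add_cos hp hcos
  refine ⟨A, B, hA, fun z hz => ?_⟩
  have harg : |Complex.arg z| < Real.pi / 2 := Complex.abs_arg_lt_pi_div_two_iff.2 (Or.inl hz)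
  have h1 := h _ harg
  have hcosn : 0 ≤ Real.cos (Complex.arg z) :=
    Real.cos_nonneg_of_neg_pi_div_two_le_of_le (abs_lt.1 harg).1.le (abs_lt.1 harg).2.le
  rw [Complex.cpow_ofReal_re, ← Complex.norm_mul_cos_arg z, Real.mul_rpow (norm_nonneg _) hcosn]
  have h2 : (‖z‖ : ℝ) ^ p * 1 ≤ ‖z‖ ^ p *
    (A * Real.cos (Complex.arg z) ^ p + B * Real.cos (Complex.arg z * p)) := by gcongr
  linarith

/-- Jensen's inequality for `t ↦ t ^ p` with respect to a probability density. -/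
lemma rpow_lintegral_mul_le {X : Type*} [MeasurableSpace X] {ν : Measure X} {W h : X → ℝ≥0∞}
    (hW : Measurable W) (hW1 : ∫⁻ x, W x ∂ν = 1) (hh : Measurable h) {p : ℝ} (hp : 1 < p) :
    (∫⁻ x, W x * h x ∂ν) ^ p ≤ ∫⁻ x, W x * h x ^ p ∂ν := by
  have hp0 : 0 < p := by linarith
  have hprob : IsProbabilityMeasure (ν.withDensity W) := ⟨by simp [hW1]⟩
  have h1 : ∫⁻ x, W x * h x ∂ν = ∫⁻ x, h x ∂(ν.withDensity W) := by
    rw [lintegral_withDensity_eq_lintegral_mul _ hW hh]; rfl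
  have h2 : ∫⁻ x, W x * h x ^ p ∂ν = ∫⁻ x, h x ^ p ∂(ν.withDensity W) := by
    rw [lintegral_withDensity_eq_lintegral_mul _ hW (hh.pow_const p)]; rfl
  rw [h1, h2]
  have h3 := ENNReal.lintegral_mul_le_Lp_mul_Lq (ν.withDensity W)
    (Real.HolderConjugate.conjExponent hp) hh.aemeasurable (g := fun _ => 1) aemeasurable_const
  simp only [Pi.mul_apply, mul_one, ENNReal.one_rpow, lintegral_one, measure_univ] at h3
  calc (∫⁻ x, h x ∂(ν.withDensity W)) ^ p
      ≤ ((∫⁻ x, h x ^ p ∂(ν.withDensity W)) ^ (1 / p)) ^ p := by gcongr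
    _ = _ := by rw [← ENNReal.rpow_mul, one_div_mul_cancel hp0.ne', ENNReal.rpow_one]

lemma integrable_szego_mul {z : ℂ} (hz : ‖z‖ < 1) {g : UnitAddCircle → ℂ}
    (hg : Integrable g AddCircle.haarAddCircle) :
    Integrable (fun θ => szego z θ * g θ) AddCircle.haarAddCircle := by
  let κ : C(UnitAddCircle, ℂ) := ⟨szego z, continuous_szego hz⟩
  exact hg.bdd_mul κ.continuous.aestronglyMeasurable
    (Filter.Eventually.of_forall fun x => κ.norm_coe_le_norm x)

lemma re_cauchyCircle_ofReal {z : ℂ} (hz : ‖z‖ < 1) {h : UnitAddCircle → ℝ}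
    (hh : Integrable h AddCircle.haarAddCircle) :
    (cauchyCircle (fun θ => (h θ : ℂ)) z).re =
      ∫ θ, (szego z θ).re * h θ ∂AddCircle.haarAddCircle := by
  have h1 := integral_re (𝕜 := ℂ) (integrable_szego_mul hz hh.ofReal)
  simp only [RCLike.re_to_complex] at h1
  unfold cauchyCircle
  erw [← h1]
  refine integral_congr_ae (Filter.Eventually.of_forall fun θ => ?_)
  exact Complex.re_mul_ofReal _ _

lemma cauchyCircle_zero (g : UnitAddCircle → ℂ) :
    cauchyCircle g 0 = ∫ θ, g θ ∂AddCircle.haarAddCircle := by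
  simp [cauchyCircle, szego]

lemma norm_ofReal_mul_toCircle {r : ℝ} (hr : r ∈ Set.Ioo (0 : ℝ) 1) (φ : UnitAddCircle) :
    ‖(r : ℂ) * (φ.toCircle : ℂ)‖ < 1 := by
  rw [norm_mul, Circle.norm_coe, mul_one, Complex.norm_real, Real.norm_of_nonneg hr.1.le]
  exact hr.2

lemma continuous_cauchyCircle_comp {r : ℝ} (hr : r ∈ Set.Ioo (0 : ℝ) 1) {g : UnitAddCircle → ℂ}
    (hg : Integrable g AddCircle.haarAddCircle) :
    Continuous fun φ : UnitAddCircle => cauchyCircle g (r * (φ.toCircle : ℂ)) := by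
  refine (differentiableOn_cauchyCircle hg).continuousOn.comp_continuous
    (continuous_const.mul continuous_coe_toCircle) fun φ => ?_
  rw [mem_ball_zero_iff]
  exact norm_ofReal_mul_toCircle hr φ

lemma continuous_szego_uncurry {r : ℝ} (hr : r ∈ Set.Ioo (0 : ℝ) 1) :
    Continuous fun x : UnitAddCircle × UnitAddCircle =>
      szego (r * (x.1.toCircle : ℂ)) x.2 := by
  unfold szego
  refine Continuous.inv₀ ?_ fun x =>
    one_sub_mul_conj_toCircle_ne_zero (norm_ofReal_mul_toCircle hr x.1) x.2
  have := continuous_coe_toCircle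
  fun_prop

lemma lintegral_re_szego {z : ℂ} (hz : ‖z‖ < 1) :
    ∫⁻ θ, ENNReal.ofReal (szego z θ).re ∂(AddCircle.haarAddCircle : Measure UnitAddCircle) = 1 := by
  rw [← ofReal_integral_eq_lintegral_ofReal, integral_re_szego hz, ENNReal.ofReal_one]
  · exact (Complex.continuous_re.comp (continuous_szego hz)).integrable_of_hasCompactSupport
      (HasCompactSupport.of_compactSpace _)
  · exact Filter.Eventually.of_forall fun θ => by
      have := half_le_re_szego hz θ
      simp only [Pi.zero_apply]
      linarith

/-- The real part of the Cauchy integral of a nonnegative function is a contraction on `L^p`. -/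
lemma lintegral_re_cauchyCircle_rpow_le {p r : ℝ} (hp : 1 < p) (hr : r ∈ Set.Ioo (0 : ℝ) 1)
    {h : UnitAddCircle → ℝ} (hm : Measurable h) (hh : Integrable h AddCircle.haarAddCircle)
    (h0 : ∀ θ, 0 ≤ h θ) :
    ∫⁻ φ : UnitAddCircle, ENNReal.ofReal
        (cauchyCircle (fun θ => (h θ : ℂ)) (r * (φ.toCircle : ℂ))).re ^ p
        ∂AddCircle.haarAddCircle ≤
      ∫⁻ θ, ENNReal.ofReal (h θ) ^ p ∂AddCircle.haarAddCircle := by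
  have hmes : Measurable fun x : UnitAddCircle × UnitAddCircle =>
      ENNReal.ofReal (szego (r * (x.1.toCircle : ℂ)) x.2).re :=
    (Complex.continuous_re.comp (continuous_szego_uncurry hr)).measurable.ennreal_ofReal
  have hmes₁ : ∀ φ : UnitAddCircle, Measurable fun θ : UnitAddCircle =>
      ENNReal.ofReal (szego (r * (φ.toCircle : ℂ)) θ).re := fun φ =>
    (Complex.continuous_re.comp
      (continuous_szego (norm_ofReal_mul_toCircle hr φ))).measurable.ennreal_ofReal
  have hmh : Measurable fun θ => ENNReal.ofReal (h θ) := hm.ennreal_ofReal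
  -- Jensen's inequality for the probability density `Re szego`, pointwise in `φ`.
  have hpt : ∀ φ : UnitAddCircle, ENNReal.ofReal
      (cauchyCircle (fun θ => (h θ : ℂ)) (r * (φ.toCircle : ℂ))).re ^ p ≤
      ∫⁻ θ, ENNReal.ofReal (szego (r * (φ.toCircle : ℂ)) θ).re * ENNReal.ofReal (h θ) ^ p
        ∂AddCircle.haarAddCircle := by
    intro φ
    have hz := norm_ofReal_mul_toCircle hr φ
    rw [re_cauchyCircle_ofReal hz hh, ofReal_integral_eq_lintegral_ofReal]
    · have h1 : ∀ θ, ENNReal.ofReal ((szego (r * (φ.toCircle : ℂ)) θ).re * h θ) =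
          ENNReal.ofReal (szego (r * (φ.toCircle : ℂ)) θ).re * ENNReal.ofReal (h θ) := fun θ =>
        ENNReal.ofReal_mul (by linarith [half_le_re_szego hz θ])
      simp_rw [h1]
      exact rpow_lintegral_mul_le (hmes₁ φ) (lintegral_re_szego hz) hmh hp
    · have h2 : Integrable (fun θ => (szego (r * (φ.toCircle : ℂ)) θ * (h θ : ℂ)).re)
          AddCircle.haarAddCircle := (integrable_szego_mul hz hh.ofReal).re
      refine h2.congr (Filter.Eventually.of_forall fun θ => ?_)
      exact Complex.re_mul_ofReal _ _
    · exact Filter.Eventually.of_forall fun θ =>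
        mul_nonneg (by linarith [half_le_re_szego hz θ]) (h0 θ)
  calc _ ≤ ∫⁻ φ : UnitAddCircle, ∫⁻ θ, ENNReal.ofReal (szego (r * (φ.toCircle : ℂ)) θ).re *
        ENNReal.ofReal (h θ) ^ p ∂AddCircle.haarAddCircle ∂AddCircle.haarAddCircle :=
        lintegral_mono hpt
    _ = ∫⁻ θ : UnitAddCircle, ∫⁻ φ, ENNReal.ofReal (szego (r * (φ.toCircle : ℂ)) θ).re *
        ENNReal.ofReal (h θ) ^ p ∂AddCircle.haarAddCircle ∂AddCircle.haarAddCircle :=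
        lintegral_lintegral_swap
          (hmes.mul ((hmh.pow_const p).comp measurable_snd)).aemeasurable
    _ = _ := by
        refine lintegral_congr fun θ => ?_
        -- The symmetry turns the integral over `φ` into a mass-one integral with `θ` fixed.
        simp_rw [szego_symm r _ θ]
        rw [lintegral_mul_const _ (hmes₁ θ),
          lintegral_re_szego (norm_ofReal_mul_toCircle hr θ), one_mul]

lemma Continuous.integrable_haarAddCircle {f : UnitAddCircle → ℝ} (hf : Continuous f) :
    Integrable f AddCircle.haarAddCircle :=
  hf.integrable_of_hasCompactSupport (HasCompactSupport.of_compactSpace _)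

/-- Integrate the half-plane inequality along `F(r e^{iφ})`. The `(Re F) ^ p` term is handled by the
contraction bound, and the mean of `F ^ p` is `(∫ h) ^ p`, bounded by Jensen. -/
lemma exists_lintegral_cauchyCircle_rpow_le_of_nonneg {p : ℝ} (hp : 1 < p)
    (hcos : Real.cos (p * (Real.pi / 2)) ≠ 0) :
    ∃ A : ℝ≥0∞, A ≠ ∞ ∧ ∀ r ∈ Set.Ioo (0 : ℝ) 1, ∀ h : UnitAddCircle → ℝ, Measurable h →
      Integrable h AddCircle.haarAddCircle → (∀ θ, 0 ≤ h θ) →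
      ∫⁻ φ : UnitAddCircle, ‖cauchyCircle (fun θ => (h θ : ℂ)) (r * (φ.toCircle : ℂ))‖ₑ ^ p
        ∂AddCircle.haarAddCircle ≤
      A * ∫⁻ θ, ENNReal.ofReal (h θ) ^ p ∂AddCircle.haarAddCircle := by
  have hp0 : 0 < p := by linarith
  obtain ⟨A, B, hA, hAB⟩ := exists_norm_rpow_le_re_rpow_add_re_cpow hp0 hcos
  refine ⟨ENNReal.ofReal A + ENNReal.ofReal |B|, by simp, fun r hr h hm hh h0 => ?_⟩
  set F := cauchyCircle (fun θ => (h θ : ℂ)) with hF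
  have hnn : 0 ≤ ∫ θ, h θ ∂AddCircle.haarAddCircle := integral_nonneg h0
  -- `∫ h = 0` must be split off: then `F` vanishes identically, whereas otherwise `Re F ≥ (1/2) ∫ h
  -- > 0`.
  rcases hnn.eq_or_lt with hz | hpos
  · have h1 : h =ᵐ[AddCircle.haarAddCircle] 0 := (integral_eq_zero_iff_of_nonneg h0 hh).1 hz.symm
    have h2 : ∀ z, F z = 0 := fun z => by
      rw [hF, cauchyCircle]
      refine integral_eq_zero_of_ae ?_
      filter_upwards [h1] with θ hθ
      simp [hθ]
    simp [h2, hp0]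
  have hre : ∀ z : ℂ, ‖z‖ < 1 → 0 < (F z).re := fun z hz => by
    rw [hF, re_cauchyCircle_ofReal hz hh]
    have h2 : Integrable (fun θ => (szego z θ * (h θ : ℂ)).re) AddCircle.haarAddCircle :=
      (integrable_szego_mul hz hh.ofReal).re
    simp only [Complex.re_mul_ofReal] at h2
    calc 0 < 1 / 2 * ∫ θ, h θ ∂AddCircle.haarAddCircle := by positivity
      _ = ∫ θ, 1 / 2 * h θ ∂AddCircle.haarAddCircle := (integral_const_mul _ _).symm
      _ ≤ _ := integral_mono (hh.const_mul _) h2 fun θ =>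
        mul_le_mul_of_nonneg_right (half_le_re_szego hz θ) (h0 θ)
  have hmem : ∀ z : ℂ, ‖z‖ ≤ 1 → ‖(r : ℂ) * z‖ < 1 := fun z hz => by
    rw [norm_mul, Complex.norm_real, Real.norm_of_nonneg hr.1.le]
    nlinarith [hr.1, hr.2, norm_nonneg z]
  have hFd : DifferentiableOn ℂ F (Metric.ball 0 1) := differentiableOn_cauchyCircle hh.ofReal
  -- Since `r < 1`, the closed disc is sent into the open one, and there `Re F > 0` keeps the
  -- principal power holomorphic.
  have hG : DiffContOnCl ℂ (fun z : ℂ => F (r * z) ^ (p : ℂ)) (Metric.ball 0 1) := by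
    refine DifferentiableOn.diffContOnCl_ball (U := Metric.closedBall 0 1) ?_ subset_rfl
    refine DifferentiableOn.cpow_const (hFd.comp (by fun_prop) fun z hz => ?_) fun z hz => ?_
    · exact mem_ball_zero_iff.2 (hmem z (mem_closedBall_zero_iff.1 hz))
    · exact Or.inl (hre _ (hmem z (mem_closedBall_zero_iff.1 hz)))
  -- Cauchy's formula at the centre, where `F 0 = ∫ h`.
  have hmean : ∫ φ : UnitAddCircle, F (r * (φ.toCircle : ℂ)) ^ (p : ℂ) ∂AddCircle.haarAddCircle =
      (((∫ θ, h θ ∂AddCircle.haarAddCircle) ^ p : ℝ) : ℂ) := by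
    have h1 := integral_szego_mul hG (z := 0) (by simp)
    simp only [szego, zero_mul, sub_zero, inv_one, one_mul, mul_zero] at h1
    rw [h1, hF, cauchyCircle_zero, integral_complex_ofReal, Complex.ofReal_cpow hnn]
  have hFc : Continuous fun φ : UnitAddCircle => F (r * (φ.toCircle : ℂ)) :=
    continuous_cauchyCircle_comp hr hh.ofReal
  have hreφ : ∀ φ : UnitAddCircle, 0 < (F (r * (φ.toCircle : ℂ))).re := fun φ =>
    hre _ (norm_ofReal_mul_toCircle hr φ)
  have hc1 : Continuous fun φ : UnitAddCircle => ‖F (r * (φ.toCircle : ℂ))‖ ^ p :=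
    hFc.norm.rpow_const fun _ => Or.inr hp0.le
  have hc2 : Continuous fun φ : UnitAddCircle => (F (r * (φ.toCircle : ℂ))).re ^ p :=
    (Complex.continuous_re.comp hFc).rpow_const fun _ => Or.inr hp0.le
  have hc3 : Continuous fun φ : UnitAddCircle => F (r * (φ.toCircle : ℂ)) ^ (p : ℂ) :=
    hFc.cpow continuous_const fun φ => Or.inl (hreφ φ)
  have hc4 : Continuous fun φ : UnitAddCircle => (F (r * (φ.toCircle : ℂ)) ^ (p : ℂ)).re :=
    Complex.continuous_re.comp hc3
  have hmean_re : ∫ φ : UnitAddCircle, (F (r * (φ.toCircle : ℂ)) ^ (p : ℂ)).re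
      ∂AddCircle.haarAddCircle = (∫ θ, h θ ∂AddCircle.haarAddCircle) ^ p := by
    have h1 := integral_re (𝕜 := ℂ) (hc3.integrable_of_hasCompactSupport (HasCompactSupport.of_compactSpace _)
      (μ := AddCircle.haarAddCircle))
    simp only [RCLike.re_to_complex] at h1
    rw [h1, hmean, Complex.ofReal_re]
  have hreal : ∫ φ : UnitAddCircle, ‖F (r * (φ.toCircle : ℂ))‖ ^ p ∂AddCircle.haarAddCircle ≤
      A * (∫ φ : UnitAddCircle, (F (r * (φ.toCircle : ℂ))).re ^ p ∂AddCircle.haarAddCircle) +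
        |B| * (∫ θ, h θ ∂AddCircle.haarAddCircle) ^ p := by
    calc _ ≤ ∫ φ : UnitAddCircle, (A * (F (r * (φ.toCircle : ℂ))).re ^ p +
          B * (F (r * (φ.toCircle : ℂ)) ^ (p : ℂ)).re) ∂AddCircle.haarAddCircle :=
          integral_mono hc1.integrable_haarAddCircle
            ((hc2.const_mul A).add (hc4.const_mul B)).integrable_haarAddCircle
            fun φ => hAB _ (hreφ φ)
      _ = A * (∫ φ : UnitAddCircle, (F (r * (φ.toCircle : ℂ))).re ^ p
            ∂AddCircle.haarAddCircle) + B * (∫ θ, h θ ∂AddCircle.haarAddCircle) ^ p := by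
          rw [integral_add (hc2.const_mul A).integrable_haarAddCircle
            (hc4.const_mul B).integrable_haarAddCircle, integral_const_mul, integral_const_mul,
            hmean_re]
      _ ≤ _ := by gcongr; exact le_abs_self B
  have hmh : Measurable fun θ => ENNReal.ofReal (h θ) := hm.ennreal_ofReal
  have hjensen : ENNReal.ofReal ((∫ θ, h θ ∂AddCircle.haarAddCircle) ^ p) ≤
      ∫⁻ θ, ENNReal.ofReal (h θ) ^ p ∂AddCircle.haarAddCircle := by
    have h1 := rpow_lintegral_mul_le (ν := (AddCircle.haarAddCircle : Measure UnitAddCircle))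
      (W := fun _ => 1) measurable_const (by simp) hmh hp
    simp only [one_mul] at h1
    rwa [← ENNReal.ofReal_rpow_of_nonneg hnn hp0.le,
      ofReal_integral_eq_lintegral_ofReal hh (Filter.Eventually.of_forall h0)]
  have hcontr : ENNReal.ofReal (∫ φ : UnitAddCircle, (F (r * (φ.toCircle : ℂ))).re ^ p
      ∂AddCircle.haarAddCircle) ≤ ∫⁻ θ, ENNReal.ofReal (h θ) ^ p ∂AddCircle.haarAddCircle := by
    rw [ofReal_integral_eq_lintegral_ofReal hc2.integrable_haarAddCircle
      (Filter.Eventually.of_forall fun φ => Real.rpow_nonneg (hreφ φ).le p)]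
    refine le_trans (lintegral_mono fun φ => ?_) (lintegral_re_cauchyCircle_rpow_le hp hr hm hh h0)
    rw [ENNReal.ofReal_rpow_of_nonneg (hreφ φ).le hp0.le]
  calc ∫⁻ φ : UnitAddCircle, ‖F (r * (φ.toCircle : ℂ))‖ₑ ^ p ∂AddCircle.haarAddCircle
      = ∫⁻ φ : UnitAddCircle, ENNReal.ofReal (‖F (r * (φ.toCircle : ℂ))‖ ^ p)
          ∂AddCircle.haarAddCircle := by
        refine lintegral_congr fun φ => ?_
        rw [← ofReal_norm, ENNReal.ofReal_rpow_of_nonneg (norm_nonneg _) hp0.le]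
    _ = ENNReal.ofReal (∫ φ : UnitAddCircle, ‖F (r * (φ.toCircle : ℂ))‖ ^ p
          ∂AddCircle.haarAddCircle) := by
        rw [ofReal_integral_eq_lintegral_ofReal hc1.integrable_haarAddCircle
          (Filter.Eventually.of_forall fun φ => by positivity)]
    _ ≤ _ := (ENNReal.ofReal_le_ofReal hreal).trans ENNReal.ofReal_add_le
    _ ≤ _ := by
        rw [ENNReal.ofReal_mul hA, ENNReal.ofReal_mul (abs_nonneg B), add_mul]
        gcongr

lemma cauchyCircle_add {z : ℂ} (hz : ‖z‖ < 1) {g h : UnitAddCircle → ℂ}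
    (hg : Integrable g AddCircle.haarAddCircle) (hh : Integrable h AddCircle.haarAddCircle) :
    cauchyCircle (g + h) z = cauchyCircle g z + cauchyCircle h z := by
  unfold cauchyCircle
  rw [← integral_add (integrable_szego_mul hz hg) (integrable_szego_mul hz hh)]
  simp [mul_add]

lemma cauchyCircle_const_mul (z c : ℂ) (g : UnitAddCircle → ℂ) :
    cauchyCircle (fun θ => c * g θ) z = c * cauchyCircle g z := by
  unfold cauchyCircle
  rw [← integral_const_mul]
  congr 1
  ext θ
  ring

lemma exists_lintegral_cauchyCircle_rpow_le_of_cos_ne_zero {p : ℝ} (hp : 1 < p)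
    (hcos : Real.cos (p * (Real.pi / 2)) ≠ 0) :
    ∃ A : ℝ≥0∞, A ≠ ∞ ∧ ∀ r ∈ Set.Ioo (0 : ℝ) 1, ∀ g : UnitAddCircle → ℂ, Measurable g →
      Integrable g AddCircle.haarAddCircle →
      ∫⁻ φ : UnitAddCircle, ‖cauchyCircle g (r * (φ.toCircle : ℂ))‖ₑ ^ p
        ∂AddCircle.haarAddCircle ≤
      A * ∫⁻ θ, ‖g θ‖ₑ ^ p ∂AddCircle.haarAddCircle := by
  have hp0 : 0 < p := by linarith
  obtain ⟨A, hA, hAB⟩ := exists_lintegral_cauchyCircle_rpow_le_of_nonneg hp hcos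
  -- The constant in `(a + b) ^ p ≤ 2 ^ (p - 1) (a ^ p + b ^ p)`, applied on two nested levels to
  -- the positive and negative parts of `Re g` and `Im g`.
  set D : ℝ≥0∞ := 2 ^ (p - 1) with hD
  have hDt : D ≠ ∞ := ENNReal.rpow_ne_top_of_nonneg (by linarith) (by simp)
  refine ⟨D * (D * (A + A) + D * (A + A)), by finiteness, fun r hr g hm hg => ?_⟩
  let h : Fin 4 → UnitAddCircle → ℝ := fun j θ =>
    max (![(g θ).re, -(g θ).re, (g θ).im, -(g θ).im] j) 0
  have hh0 : ∀ j θ, 0 ≤ h j θ := fun j θ => le_max_right _ _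
  have hhm : ∀ j, Measurable (h j) := by
    intro j
    fin_cases j <;> simp only [h] <;> simp <;> fun_prop
  have hhle : ∀ j θ, h j θ ≤ ‖g θ‖ := by
    intro j θ
    have h1 := abs_le.1 (Complex.abs_re_le_norm (g θ))
    have h2 := abs_le.1 (Complex.abs_im_le_norm (g θ))
    refine max_le ?_ (norm_nonneg _)
    fin_cases j <;> simp <;> linarith
  have hhi : ∀ j, Integrable (h j) AddCircle.haarAddCircle := fun j =>
    hg.norm.mono' (hhm j).aestronglyMeasurable (Filter.Eventually.of_forall fun θ => by
      rw [Real.norm_of_nonneg (hh0 j θ)]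
      exact hhle j θ)
  let H : Fin 4 → UnitAddCircle → ℂ := fun j θ => (h j θ : ℂ)
  have hHi : ∀ j, Integrable (H j) AddCircle.haarAddCircle := fun j => (hhi j).ofReal
  have hdec : g = (H 0 + fun θ => (-1) * H 1 θ) +
      ((fun θ => Complex.I * H 2 θ) + fun θ => (-Complex.I) * H 3 θ) := by
    have hmax : ∀ x : ℝ, max x 0 - max (-x) 0 = x := fun x => by
      rcases le_total x 0 with hx | hx
      · rw [max_eq_right hx, max_eq_left (by linarith)]; ring
      · rw [max_eq_left hx, max_eq_right (by linarith)]; ring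
    funext θ
    apply Complex.ext
    · simpa [H, h, sub_eq_add_neg] using (hmax (g θ).re).symm
    · simpa [H, h, sub_eq_add_neg] using (hmax (g θ).im).symm
  have hle : ∀ z : ℂ, ‖z‖ < 1 → ‖cauchyCircle g z‖ₑ ≤
      (‖cauchyCircle (H 0) z‖ₑ + ‖cauchyCircle (H 1) z‖ₑ) +
      (‖cauchyCircle (H 2) z‖ₑ + ‖cauchyCircle (H 3) z‖ₑ) := by
    intro z hz
    conv_lhs => rw [hdec]
    rw [cauchyCircle_add hz ((hHi 0).add ((hHi 1).const_mul _))
      (((hHi 2).const_mul _).add ((hHi 3).const_mul _)),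
      cauchyCircle_add hz (hHi 0) ((hHi 1).const_mul _),
      cauchyCircle_add hz ((hHi 2).const_mul _) ((hHi 3).const_mul _),
      cauchyCircle_const_mul, cauchyCircle_const_mul, cauchyCircle_const_mul]
    refine (enorm_add_le _ _).trans (add_le_add ((enorm_add_le _ _).trans ?_)
      ((enorm_add_le _ _).trans ?_))
    · simp
    · have hI : ‖Complex.I‖ₑ = 1 := by simp [← ofReal_norm]
      simp [enorm_mul, hI]
  let a : Fin 4 → UnitAddCircle → ℝ≥0∞ := fun j φ =>
    ‖cauchyCircle (H j) (r * (φ.toCircle : ℂ))‖ₑ ^ p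
  have ham : ∀ j, Measurable (a j) := fun j =>
    (continuous_cauchyCircle_comp hr (hHi j)).measurable.enorm.pow_const p
  have hai : ∀ j, ∫⁻ φ, a j φ ∂AddCircle.haarAddCircle ≤
      A * ∫⁻ θ, ‖g θ‖ₑ ^ p ∂AddCircle.haarAddCircle := by
    intro j
    refine (hAB r hr (h j) (hhm j) (hhi j) (hh0 j)).trans ?_
    gcongr with θ
    rw [← ofReal_norm]
    exact ENNReal.ofReal_le_ofReal (hhle j θ)
  calc ∫⁻ φ : UnitAddCircle, ‖cauchyCircle g (r * (φ.toCircle : ℂ))‖ₑ ^ p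
        ∂AddCircle.haarAddCircle
      ≤ ∫⁻ φ : UnitAddCircle, D * (D * (a 0 φ + a 1 φ) + D * (a 2 φ + a 3 φ))
        ∂AddCircle.haarAddCircle := by
        refine lintegral_mono fun φ => ?_
        refine (ENNReal.rpow_le_rpow (hle _ (norm_ofReal_mul_toCircle hr φ)) hp0.le).trans ?_
        refine (ENNReal.rpow_add_le_mul_rpow_add_rpow _ _ hp.le).trans ?_
        gcongr
        · exact ENNReal.rpow_add_le_mul_rpow_add_rpow _ _ hp.le
        · exact ENNReal.rpow_add_le_mul_rpow_add_rpow _ _ hp.le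
    _ = D * (D * (∫⁻ φ, a 0 φ ∂AddCircle.haarAddCircle + ∫⁻ φ, a 1 φ ∂AddCircle.haarAddCircle) +
          D * (∫⁻ φ, a 2 φ ∂AddCircle.haarAddCircle + ∫⁻ φ, a 3 φ ∂AddCircle.haarAddCircle)) := by
        have h₁ : Measurable fun φ => D * (a 0 φ + a 1 φ) := ((ham 0).add (ham 1)).const_mul D
        have h₂ : Measurable fun φ => D * (a 2 φ + a 3 φ) := ((ham 2).add (ham 3)).const_mul D
        have h₃ : Measurable fun φ => D * (a 0 φ + a 1 φ) + D * (a 2 φ + a 3 φ) := h₁.add h₂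
        have h₄ : Measurable fun φ => a 0 φ + a 1 φ := (ham 0).add (ham 1)
        have h₅ : Measurable fun φ => a 2 φ + a 3 φ := (ham 2).add (ham 3)
        rw [lintegral_const_mul _ h₃, lintegral_add_left h₁, lintegral_const_mul _ h₄,
          lintegral_const_mul _ h₅, lintegral_add_left (ham 0), lintegral_add_left (ham 2)]
    _ ≤ D * (D * (A * (∫⁻ θ, ‖g θ‖ₑ ^ p ∂AddCircle.haarAddCircle) +
            A * (∫⁻ θ, ‖g θ‖ₑ ^ p ∂AddCircle.haarAddCircle)) +
          D * (A * (∫⁻ θ, ‖g θ‖ₑ ^ p ∂AddCircle.haarAddCircle) +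
            A * (∫⁻ θ, ‖g θ‖ₑ ^ p ∂AddCircle.haarAddCircle))) := by
        gcongr <;> exact hai _
    _ = _ := by ring

/-- **M. Riesz's theorem**: the Cauchy integral is bounded from `L^p` of the circle to the Hardy
space `H^p` of the disc, `1 < p < ∞`. -/
theorem exists_lintegral_cauchyCircle_rpow_le {p : ℝ} (hp : 1 < p) :
    ∃ A : ℝ≥0∞, A ≠ ∞ ∧ ∀ r ∈ Set.Ioo (0 : ℝ) 1, ∀ g : UnitAddCircle → ℂ, Measurable g →
      Integrable g AddCircle.haarAddCircle →
      ∫⁻ φ : UnitAddCircle, ‖cauchyCircle g (r * (φ.toCircle : ℂ))‖ₑ ^ p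
        ∂AddCircle.haarAddCircle ≤
      A * ∫⁻ θ, ‖g θ‖ₑ ^ p ∂AddCircle.haarAddCircle := by
  by_cases hcos : Real.cos (p * (Real.pi / 2)) = 0
  swap
  · exact exists_lintegral_cauchyCircle_rpow_le_of_cos_ne_zero hp hcos
  -- `s ≤ (p - 1) / 2` keeps `p - s > 1`, and `s ≤ 1` keeps `sin (s π / 2) ≠ 0`, so by the addition
  -- formulas neither cosine at `p ± s` vanishes.
  set s := min 1 ((p - 1) / 2) with hs
  have hs0 : 0 < s := lt_min one_pos (by linarith)
  have hs1 : s ≤ 1 := min_le_left _ _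
  have hs2 : s ≤ (p - 1) / 2 := min_le_right _ _
  have hpi := Real.pi_pos
  have hsin : Real.sin (p * (Real.pi / 2)) ≠ 0 := fun h => by
    have := Real.sin_sq_add_cos_sq (p * (Real.pi / 2))
    rw [h, hcos] at this
    norm_num at this
  have hsins : Real.sin (s * (Real.pi / 2)) ≠ 0 :=
    (Real.sin_pos_of_pos_of_lt_pi (by positivity) (by nlinarith)).ne'
  have hc₀ : Real.cos ((p - s) * (Real.pi / 2)) ≠ 0 := by
    rw [sub_mul, Real.cos_sub, hcos, zero_mul, zero_add]
    exact mul_ne_zero hsin hsins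
  have hc₁ : Real.cos ((p + s) * (Real.pi / 2)) ≠ 0 := by
    rw [add_mul, Real.cos_add, hcos, zero_mul, zero_sub]
    exact neg_ne_zero.2 (mul_ne_zero hsin hsins)
  obtain ⟨A, hA, hA'⟩ := exists_lintegral_cauchyCircle_rpow_le_of_cos_ne_zero
    (by linarith : 1 < p - s) hc₀
  obtain ⟨B, hB, hB'⟩ := exists_lintegral_cauchyCircle_rpow_le_of_cos_ne_zero
    (by linarith : 1 < p + s) hc₁
  refine ⟨ENNReal.ofReal p * (ENNReal.ofReal (2 ^ (p - s)) * A *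
    ENNReal.ofReal (1 / (p - (p - s))) + ENNReal.ofReal (2 ^ (p + s)) * B *
    ENNReal.ofReal (1 / (p + s - p))), ?_, fun r hr g hm hg => ?_⟩
  · finiteness
  · let T : (UnitAddCircle → ℂ) → UnitAddCircle → ℂ :=
      fun g φ => cauchyCircle g (r * (φ.toCircle : ℂ))
    have hadd : ∀ g h : UnitAddCircle → ℂ, Measurable g → Measurable h →
        Integrable g AddCircle.haarAddCircle → Integrable h AddCircle.haarAddCircle →
        ∀ φ, ‖T (g + h) φ‖ ≤ ‖T g φ‖ + ‖T h φ‖ := by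
      intro g h _ _ hg hh φ
      simp only [T]
      rw [cauchyCircle_add (norm_ofReal_mul_toCircle hr φ) hg hh]
      exact norm_add_le _ _
    have hmeas : ∀ g : UnitAddCircle → ℂ, Measurable g → Integrable g AddCircle.haarAddCircle →
        AEMeasurable (T g) AddCircle.haarAddCircle := fun g _ hg =>
      (continuous_cauchyCircle_comp hr hg).measurable.aemeasurable
    exact lintegral_enorm_rpow_le_of_strong_type T (by linarith : 0 < p - s)
      (by linarith : p - s < p) (by linarith : p < p + s) hadd hmeas (hA' r hr) (hB' r hr) hm hg

/-! ### Product structure of the torus and Cauchy's formula on the polydisc -/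

instance (d : ℕ) : IsProbabilityMeasure (torusHaar d) := by
  unfold torusHaar; infer_instance

/-- Prepend a coordinate to a point of the torus. -/
def torusCons {d : ℕ} (x : UnitAddCircle) (y : UnitAddTorus (Fin d)) :
    UnitAddTorus (Fin (d + 1)) :=
  Fin.cons (α := fun _ => UnitAddCircle) x y

/-- Prepend a coordinate to a complex vector. -/
def complexCons {d : ℕ} (x : ℂ) (y : Fin d → ℂ) : Fin (d + 1) → ℂ :=
  Fin.cons (α := fun _ => ℂ) x y

lemma torusPoint_torusCons {d : ℕ} (x : UnitAddCircle) (y : UnitAddTorus (Fin d)) :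
    torusPoint (torusCons x y) = complexCons (x.toCircle : ℂ) (torusPoint y) := by
  funext i
  refine Fin.cases ?_ (fun j => ?_) i
  · rfl
  · rfl

lemma smul_complexCons {d : ℕ} (r x : ℂ) (y : Fin d → ℂ) :
    r • complexCons x y = complexCons (r * x) (r • y) := by
  funext i
  refine Fin.cases ?_ (fun j => ?_) i
  · rfl
  · rfl

lemma szegoPi_complexCons {d : ℕ} (x : ℂ) (y : Fin d → ℂ) (s : UnitAddCircle)
    (t : UnitAddTorus (Fin d)) :
    szegoPi (complexCons x y) (torusCons s t) = szego x s * szegoPi y t := by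
  unfold szegoPi
  rw [Fin.prod_univ_succ]
  rfl

lemma torusCons_eq_piFinSuccAbove_symm (d : ℕ) :
    (fun x : UnitAddCircle × UnitAddTorus (Fin d) => torusCons x.1 x.2) =
      (MeasurableEquiv.piFinSuccAbove (fun _ : Fin (d + 1) => UnitAddCircle) 0).symm := by
  funext x
  exact (Fin.insertNth_zero' (β := UnitAddCircle) x.1 x.2).symm

lemma measurePreserving_torusCons (d : ℕ) :
    MeasurePreserving (fun x : UnitAddCircle × UnitAddTorus (Fin d) => torusCons x.1 x.2)
      (AddCircle.haarAddCircle.prod (torusHaar d)) (torusHaar (d + 1)) := by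
  rw [torusCons_eq_piFinSuccAbove_symm]
  exact (measurePreserving_piFinSuccAbove
    (fun _ : Fin (d + 1) => (AddCircle.haarAddCircle : Measure UnitAddCircle)) 0).symm

lemma measurableEmbedding_torusCons (d : ℕ) :
    MeasurableEmbedding (fun x : UnitAddCircle × UnitAddTorus (Fin d) => torusCons x.1 x.2) := by
  rw [torusCons_eq_piFinSuccAbove_symm]
  exact MeasurableEquiv.measurableEmbedding _

lemma lintegral_torusHaar_succ {d : ℕ} {f : UnitAddTorus (Fin (d + 1)) → ℝ≥0∞}
    (hf : Measurable f) :
    ∫⁻ θ, f θ ∂(torusHaar (d + 1)) =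
      ∫⁻ x, ∫⁻ y, f (torusCons x y) ∂(torusHaar d) ∂AddCircle.haarAddCircle := by
  rw [← (measurePreserving_torusCons d).lintegral_comp hf]
  exact lintegral_prod _ (hf.comp (measurePreserving_torusCons d).measurable).aemeasurable

lemma integrable_comp_torusCons {d : ℕ} {f : UnitAddTorus (Fin (d + 1)) → ℂ}
    (hf : Integrable f (torusHaar (d + 1))) :
    Integrable (fun x : UnitAddCircle × UnitAddTorus (Fin d) => f (torusCons x.1 x.2))
      (AddCircle.haarAddCircle.prod (torusHaar d)) :=
  (measurePreserving_torusCons d).integrable_comp_of_integrable hf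

lemma integral_torusHaar_succ {d : ℕ} {f : UnitAddTorus (Fin (d + 1)) → ℂ}
    (hf : Integrable f (torusHaar (d + 1))) :
    ∫ θ, f θ ∂(torusHaar (d + 1)) =
      ∫ x, ∫ y, f (torusCons x y) ∂(torusHaar d) ∂AddCircle.haarAddCircle := by
  rw [← (measurePreserving_torusCons d).integral_comp (measurableEmbedding_torusCons d)]
  exact integral_prod _ (integrable_comp_torusCons hf)

lemma continuous_torusPoint {d : ℕ} :
    Continuous (torusPoint : UnitAddTorus (Fin d) → Fin d → ℂ) :=
  continuous_pi fun i => continuous_coe_toCircle.comp (continuous_apply i)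

lemma continuous_szegoPi {d : ℕ} {z : Fin d → ℂ} (hz : z ∈ polydisc d) :
    Continuous (szegoPi z) :=
  continuous_finsetProd _ fun i _ => (continuous_szego (hz i)).comp (continuous_apply i)

lemma smul_torusPoint_mem_polydisc {d : ℕ} {r : ℝ} (hr : r ∈ Set.Ioo (0 : ℝ) 1)
    (φ : UnitAddTorus (Fin d)) : (r : ℂ) • torusPoint φ ∈ polydisc d := fun i =>
  norm_ofReal_mul_toCircle hr (φ i)

lemma continuous_szegoPi_uncurry {d : ℕ} {r : ℝ} (hr : r ∈ Set.Ioo (0 : ℝ) 1) :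
    Continuous fun x : UnitAddTorus (Fin d) × UnitAddTorus (Fin d) =>
      szegoPi ((r : ℂ) • torusPoint x.1) x.2 := by
  have h : ∀ i, Continuous fun x : UnitAddTorus (Fin d) × UnitAddTorus (Fin d) =>
      szego (r * ((x.1 i).toCircle : ℂ)) (x.2 i) := fun i => by
    unfold szego
    refine Continuous.inv₀ ?_ fun x =>
      one_sub_mul_conj_toCircle_ne_zero (norm_ofReal_mul_toCircle hr (x.1 i)) (x.2 i)
    have := continuous_coe_toCircle
    fun_prop
  exact continuous_finsetProd Finset.univ fun i _ => h i

lemma integrable_szegoPi_mul {d : ℕ} {z : Fin d → ℂ} (hz : z ∈ polydisc d)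
    {g : UnitAddTorus (Fin d) → ℂ} (hg : Integrable g (torusHaar d)) :
    Integrable (fun θ => szegoPi z θ * g θ) (torusHaar d) := by
  let κ : C(UnitAddTorus (Fin d), ℂ) := ⟨szegoPi z, continuous_szegoPi hz⟩
  exact hg.bdd_mul κ.continuous.aestronglyMeasurable
    (Filter.Eventually.of_forall fun x => κ.norm_coe_le_norm x)

lemma continuous_cauchyTorus_comp {d : ℕ} {r : ℝ} (hr : r ∈ Set.Ioo (0 : ℝ) 1)
    {g : UnitAddTorus (Fin d) → ℂ} (hg : Integrable g (torusHaar d)) :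
    Continuous fun φ : UnitAddTorus (Fin d) => cauchyTorus g ((r : ℂ) • torusPoint φ) :=
  (differentiableOn_cauchyTorus hg).continuousOn.comp_continuous
    (continuous_torusPoint.fun_const_smul (r : ℂ)) (smul_torusPoint_mem_polydisc hr)

lemma cauchyTorus_of_dim_zero (g : UnitAddTorus (Fin 0) → ℂ) (z : Fin 0 → ℂ)
    (φ : UnitAddTorus (Fin 0)) : cauchyTorus g z = g φ := by
  have h : ∀ θ, szegoPi z θ * g θ = g φ := fun θ => by
    rw [Subsingleton.elim θ φ]
    simp [szegoPi]
  simp [cauchyTorus, h]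

lemma complexCons_mem_polydisc {d : ℕ} {x : ℂ} {y : Fin d → ℂ} (hx : ‖x‖ < 1)
    (hy : y ∈ polydisc d) : complexCons x y ∈ polydisc (d + 1) := fun i => by
  refine Fin.cases ?_ (fun j => ?_) i
  · exact hx
  · exact hy j

/-- Fubini for the product kernel. This is the inductive step for both Cauchy's formula and Riesz's
theorem on the polydisc. -/
lemma cauchyTorus_complexCons {d : ℕ} {g : UnitAddTorus (Fin (d + 1)) → ℂ}
    (hg : Integrable g (torusHaar (d + 1))) {x : ℂ} {y : Fin d → ℂ} (hx : ‖x‖ < 1)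
    (hy : y ∈ polydisc d) :
    cauchyTorus g (complexCons x y) =
      cauchyCircle (fun s => cauchyTorus (fun t => g (torusCons s t)) y) x := by
  unfold cauchyCircle
  rw [cauchyTorus, integral_torusHaar_succ
    (integrable_szegoPi_mul (complexCons_mem_polydisc hx hy) hg)]
  refine integral_congr_ae (Filter.Eventually.of_forall fun s => ?_)
  simp only [cauchyTorus]
  rw [← integral_const_mul]
  refine integral_congr_ae (Filter.Eventually.of_forall fun t => ?_)
  simp only [szegoPi_complexCons, mul_assoc]

lemma differentiable_complexCons_left {d : ℕ} (y : Fin d → ℂ) :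
    Differentiable ℂ fun x : ℂ => complexCons x y := by
  refine differentiable_pi.2 fun i => ?_
  refine Fin.cases ?_ (fun j => ?_) i
  · exact differentiable_id
  · exact differentiable_const _

lemma differentiable_complexCons_right {d : ℕ} (x : ℂ) :
    Differentiable ℂ fun y : Fin d → ℂ => complexCons x y := by
  refine differentiable_pi.2 fun i => ?_
  refine Fin.cases ?_ (fun j => ?_) i
  · exact differentiable_const _
  · exact differentiable_apply j

/-- Cauchy's integral formula for the polydisc. -/
theorem cauchyTorus_comp_torusPoint {d : ℕ} {R : ℝ} (hR : 1 < R) {f : (Fin d → ℂ) → ℂ}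
    (hf : DifferentiableOn ℂ f {z | ∀ i, ‖z i‖ < R}) {z : Fin d → ℂ} (hz : z ∈ polydisc d) :
    cauchyTorus (fun θ => f (torusPoint θ)) z = f z := by
  induction d with
  | zero =>
    rw [cauchyTorus_of_dim_zero _ z 0]
    exact congrArg f (Subsingleton.elim _ _)
  | succ d ih =>
    have hcont : Continuous fun θ : UnitAddTorus (Fin (d + 1)) => f (torusPoint θ) := by
      refine hf.continuousOn.comp_continuous continuous_torusPoint fun θ i => ?_
      simp only [torusPoint, Circle.norm_coe]
      exact hR
    have hint : Integrable (fun θ : UnitAddTorus (Fin (d + 1)) => f (torusPoint θ))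
        (torusHaar (d + 1)) :=
      hcont.integrable_of_hasCompactSupport (HasCompactSupport.of_compactSpace _)
    obtain ⟨x, y, rfl⟩ : ∃ x y, z = complexCons x y :=
      ⟨z 0, Fin.tail z, (Fin.cons_self_tail z).symm⟩
    have hx : ‖x‖ < 1 := hz 0
    have hy : y ∈ polydisc d := fun i => hz i.succ
    rw [cauchyTorus_complexCons hint hx hy]
    -- Freezing a first coordinate of modulus `1 < R` leaves a function holomorphic on the polydisc
    -- of radius `R`, so the induction hypothesis applies.
    have h1 : ∀ s : UnitAddCircle,
        cauchyTorus (fun t => f (torusPoint (torusCons s t))) y =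
          f (complexCons (s.toCircle : ℂ) y) := by
      intro s
      simp only [torusPoint_torusCons]
      refine ih (f := fun w => f (complexCons (s.toCircle : ℂ) w)) ?_ hy
      refine hf.comp (differentiable_complexCons_right _).differentiableOn fun w hw i => ?_
      refine Fin.cases ?_ (fun j => ?_) i
      · change ‖(s.toCircle : ℂ)‖ < R
        rw [Circle.norm_coe]
        exact hR
      · exact hw j
    simp only [h1]
    refine integral_szego_mul (f := fun w => f (complexCons w y)) ?_ hx
    refine DifferentiableOn.diffContOnCl_ball (U := Metric.closedBall 0 1) ?_ subset_rfl
    refine hf.comp (differentiable_complexCons_left y).differentiableOn fun w hw i => ?_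
    refine Fin.cases ?_ (fun j => ?_) i
    · exact (mem_closedBall_zero_iff.1 hw).trans_lt hR
    · exact (hy j).trans hR

/-! ### M. Riesz's theorem on the polydisc -/

/-- **M. Riesz's theorem** for the polydisc: the Cauchy integral is bounded from `L^p` of the torus
to the Hardy space `H^p`, `1 < p < ∞`. -/
theorem exists_lintegral_cauchyTorus_rpow_le (d : ℕ) {p : ℝ} (hp : 1 < p) :
    ∃ A : ℝ≥0∞, A ≠ ∞ ∧ ∀ r ∈ Set.Ioo (0 : ℝ) 1, ∀ g : UnitAddTorus (Fin d) → ℂ, Measurable g →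
      Integrable g (torusHaar d) →
      ∫⁻ φ, ‖cauchyTorus g ((r : ℂ) • torusPoint φ)‖ₑ ^ p ∂(torusHaar d) ≤
        A * ∫⁻ θ, ‖g θ‖ₑ ^ p ∂(torusHaar d) := by
  induction d with
  | zero =>
    refine ⟨1, ENNReal.one_ne_top, fun r _ g _ _ => le_of_eq ?_⟩
    rw [one_mul]
    exact lintegral_congr fun φ => by rw [cauchyTorus_of_dim_zero g _ φ]
  | succ d ih =>
    obtain ⟨A, hA, hA'⟩ := exists_lintegral_cauchyCircle_rpow_le hp
    obtain ⟨B, hB, hB'⟩ := ih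
    refine ⟨A * B, ENNReal.mul_ne_top hA hB, fun r hr g hm hg => ?_⟩
    have hmc : Measurable fun x : UnitAddCircle × UnitAddTorus (Fin d) => g (torusCons x.1 x.2) :=
      hm.comp (measurePreserving_torusCons d).measurable
    have hic := integrable_comp_torusCons hg
    -- The Cauchy integral in the last `d` variables only. The circle theorem in `s` is applied for
    -- each `y`, then the induction hypothesis in `y` for almost every `s`, those with integrable
    -- slice.
    let G : UnitAddCircle → UnitAddTorus (Fin d) → ℂ := fun s y =>
      cauchyTorus (fun t => g (torusCons s t)) ((r : ℂ) • torusPoint y)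
    have hGm : Measurable (Function.uncurry G) := by
      have h1 : Measurable fun x : (UnitAddCircle × UnitAddTorus (Fin d)) × UnitAddTorus (Fin d) =>
          szegoPi ((r : ℂ) • torusPoint x.1.2) x.2 * g (torusCons x.1.1 x.2) :=
        ((continuous_szegoPi_uncurry hr).measurable.comp
          ((measurable_snd.comp measurable_fst).prodMk measurable_snd)).mul
          (hmc.comp ((measurable_fst.comp measurable_fst).prodMk measurable_snd))
      exact h1.stronglyMeasurable.integral_prod_right'.measurable
    have hGi : ∀ y, Integrable (fun s => G s y) AddCircle.haarAddCircle := by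
      intro y
      let κ : C(UnitAddTorus (Fin d), ℂ) :=
        ⟨szegoPi ((r : ℂ) • torusPoint y), continuous_szegoPi (smul_torusPoint_mem_polydisc hr y)⟩
      have h1 : Integrable (fun x : UnitAddCircle × UnitAddTorus (Fin d) =>
          κ x.2 * g (torusCons x.1 x.2)) (AddCircle.haarAddCircle.prod (torusHaar d)) :=
        hic.bdd_mul (κ.continuous.comp continuous_snd).aestronglyMeasurable
          (Filter.Eventually.of_forall fun x => κ.norm_coe_le_norm x.2)
      exact h1.integral_prod_left
    have hGm' : ∀ y, Measurable fun s => G s y := fun y => hGm.of_uncurry_right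
    have hmc' : ∀ s, Measurable fun t => g (torusCons s t) := fun s =>
      hmc.comp (measurable_const.prodMk measurable_id)
    have hGp : Measurable (Function.uncurry fun s y => ‖G s y‖ₑ ^ p) := hGm.enorm.pow_const p
    have hmain : Measurable fun φ : UnitAddTorus (Fin (d + 1)) =>
        ‖cauchyTorus g ((r : ℂ) • torusPoint φ)‖ₑ ^ p :=
      (continuous_cauchyTorus_comp hr hg).measurable.enorm.pow_const p
    have hmain₂ : Measurable (Function.uncurry fun (x : UnitAddCircle)
        (y : UnitAddTorus (Fin d)) =>
        ‖cauchyTorus g ((r : ℂ) • torusPoint (torusCons x y))‖ₑ ^ p) :=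
      hmain.comp (measurePreserving_torusCons d).measurable
    calc ∫⁻ φ, ‖cauchyTorus g ((r : ℂ) • torusPoint φ)‖ₑ ^ p ∂(torusHaar (d + 1))
        = ∫⁻ y, ∫⁻ x, ‖cauchyTorus g ((r : ℂ) • torusPoint (torusCons x y))‖ₑ ^ p
            ∂AddCircle.haarAddCircle ∂(torusHaar d) := by
          rw [lintegral_torusHaar_succ hmain, lintegral_lintegral_swap hmain₂.aemeasurable]
      _ = ∫⁻ y, ∫⁻ x : UnitAddCircle,
            ‖cauchyCircle (fun s => G s y) (r * (x.toCircle : ℂ))‖ₑ ^ p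
            ∂AddCircle.haarAddCircle ∂(torusHaar d) := by
          refine lintegral_congr fun y => lintegral_congr fun x => ?_
          rw [torusPoint_torusCons, smul_complexCons, cauchyTorus_complexCons hg
            (norm_ofReal_mul_toCircle hr x) (smul_torusPoint_mem_polydisc hr y)]
      _ ≤ ∫⁻ y, A * ∫⁻ s, ‖G s y‖ₑ ^ p ∂AddCircle.haarAddCircle ∂(torusHaar d) :=
          lintegral_mono fun y => hA' r hr _ (hGm' y) (hGi y)
      _ = A * ∫⁻ s, ∫⁻ y, ‖G s y‖ₑ ^ p ∂(torusHaar d) ∂AddCircle.haarAddCircle := by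
          rw [lintegral_const_mul' _ _ hA, lintegral_lintegral_swap hGp.aemeasurable]
      _ ≤ A * ∫⁻ s, B * ∫⁻ t, ‖g (torusCons s t)‖ₑ ^ p ∂(torusHaar d)
            ∂AddCircle.haarAddCircle := by
          gcongr 1
          refine lintegral_mono_ae ?_
          filter_upwards [hic.prod_right_ae] with s hs
          exact hB' r hr _ (hmc' s) hs
      _ = A * B * ∫⁻ θ, ‖g θ‖ₑ ^ p ∂(torusHaar (d + 1)) := by
          rw [lintegral_const_mul' _ _ hB, lintegral_torusHaar_succ (hm.enorm.pow_const p),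
            mul_assoc]

/-! ### Carleson measures and the Cauchy integral -/

lemma lintegral_enorm_rpow_eq_eLpNorm_rpow {X : Type*} [MeasurableSpace X] {ν : Measure X} {s : ℝ}
    (hs : 0 < s) (f : X → ℂ) :
    ∫⁻ x, ‖f x‖ₑ ^ s ∂ν = eLpNorm f (ENNReal.ofReal s) ν ^ s := by
  rw [eLpNorm_eq_lintegral_rpow_enorm_toReal (by simpa using hs) ENNReal.ofReal_ne_top,
    ENNReal.toReal_ofReal hs.le, ← ENNReal.rpow_mul, one_div_mul_cancel hs.ne', ENNReal.rpow_one]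

lemma memLp_ofReal_iff {X : Type*} [MeasurableSpace X] {ν : Measure X} {s : ℝ}
    (hs : 0 < s) {f : X → ℂ} :
    MemLp f (ENNReal.ofReal s) ν ↔ AEStronglyMeasurable f ν ∧ ∫⁻ x, ‖f x‖ₑ ^ s ∂ν < ∞ := by
  rw [lintegral_enorm_rpow_eq_eLpNorm_rpow hs, MemLp, ENNReal.rpow_lt_top_iff_of_pos hs]

lemma continuous_restrict_polydisc {d : ℕ} {f : (Fin d → ℂ) → ℂ}
    (hf : DifferentiableOn ℂ f (polydisc d)) : Continuous fun z : polydisc d => f z :=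
  continuousOn_iff_continuous_domRestrict.1 hf.continuousOn

lemma memHardy_cauchyTorus {d : ℕ} {s : ℝ} (hs : 1 < s) {g : UnitAddTorus (Fin d) → ℂ}
    (hm : Measurable g) (hg : Integrable g (torusHaar d))
    (hgs : ∫⁻ θ, ‖g θ‖ₑ ^ s ∂(torusHaar d) ≠ ∞) : MemHardy s (cauchyTorus g) := by
  obtain ⟨A, hA, h⟩ := exists_lintegral_cauchyTorus_rpow_le d hs
  refine ⟨differentiableOn_cauchyTorus hg, lt_of_le_of_lt (iSup₂_le fun r hr => h r hr g hm hg) ?_⟩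
  exact ENNReal.mul_lt_top hA.lt_top hgs.lt_top

lemma cauchyTorus_congr_ae {d : ℕ} {g h : UnitAddTorus (Fin d) → ℂ} (hgh : g =ᵐ[torusHaar d] h) :
    cauchyTorus g = cauchyTorus h := by
  funext z
  refine integral_congr_ae ?_
  filter_upwards [hgh] with θ hθ
  rw [hθ]

lemma cauchyTorus_add {d : ℕ} {z : Fin d → ℂ} (hz : z ∈ polydisc d)
    {g h : UnitAddTorus (Fin d) → ℂ} (hg : Integrable g (torusHaar d))
    (hh : Integrable h (torusHaar d)) :
    cauchyTorus (g + h) z = cauchyTorus g z + cauchyTorus h z := by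
  unfold cauchyTorus
  rw [← integral_add (integrable_szegoPi_mul hz hg) (integrable_szegoPi_mul hz hh)]
  simp [mul_add]

lemma cauchyTorus_smul {d : ℕ} (z : Fin d → ℂ) (c : ℂ) (g : UnitAddTorus (Fin d) → ℂ) :
    cauchyTorus (c • g) z = c * cauchyTorus g z := by
  unfold cauchyTorus
  rw [← integral_const_mul]
  congr 1
  ext θ
  simp only [Pi.smul_apply, smul_eq_mul]
  ring

/-- For fixed `z` the kernel is bounded on the torus, and the `L^1` norm is at most the `L^p` norm
for a probability measure. Continuity of this evaluation closes the graph below. -/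
lemma exists_norm_cauchyTorus_le {d : ℕ} {z : Fin d → ℂ} (hz : z ∈ polydisc d) (p : ℝ≥0∞)
    [hp : Fact (1 ≤ p)] :
    ∃ M : ℝ, ∀ g : Lp ℂ p (torusHaar d), ‖cauchyTorus g z‖ ≤ M * ‖g‖ := by
  let κ : C(UnitAddTorus (Fin d), ℂ) := ⟨szegoPi z, continuous_szegoPi hz⟩
  refine ⟨‖κ‖, fun g => ?_⟩
  have hgi : Integrable g (torusHaar d) := (Lp.memLp g).integrable hp.out
  have h1 : ‖cauchyTorus g z‖ ≤ ∫ θ, ‖κ‖ * ‖g θ‖ ∂(torusHaar d) := by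
    refine norm_integral_le_of_norm_le (hgi.norm.const_mul _)
      (Filter.Eventually.of_forall fun θ => ?_)
    rw [norm_mul]
    exact mul_le_mul_of_nonneg_right (κ.norm_coe_le_norm θ) (norm_nonneg _)
  rw [integral_const_mul] at h1
  refine h1.trans (mul_le_mul_of_nonneg_left ?_ (norm_nonneg κ))
  rw [integral_norm_eq_lintegral_enorm hgi.aestronglyMeasurable, Lp.norm_def,
    ← eLpNorm_one_eq_lintegral_enorm]
  exact ENNReal.toReal_mono (Lp.eLpNorm_ne_top g)
    (eLpNorm_le_eLpNorm_of_exponent_le hp.out (Lp.aestronglyMeasurable g))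

/-- A Carleson measure for `H^s` bounds the Cauchy integral from `L^s` of the torus
(closed graph theorem). -/
theorem IsCarlesonMeasure.exists_lintegral_cauchyTorus_le {d : ℕ} {s : ℝ} (hs : 1 < s)
    {μ : Measure (polydisc d)} (hμ : IsCarlesonMeasure s μ) :
    ∃ A : ℝ≥0∞, A ≠ ∞ ∧ ∀ g : UnitAddTorus (Fin d) → ℂ, Measurable g →
      Integrable g (torusHaar d) →
      ∫⁻ z : polydisc d, ‖cauchyTorus g z‖ₑ ^ s ∂μ ≤ A * ∫⁻ θ, ‖g θ‖ₑ ^ s ∂(torusHaar d) := by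
  have hs0 : 0 < s := by linarith
  have hfact : Fact (1 ≤ ENNReal.ofReal s) := ⟨by simpa using hs.le⟩
  have hint : ∀ g : Lp ℂ (ENNReal.ofReal s) (torusHaar d), Integrable g (torusHaar d) := fun g =>
    (Lp.memLp g).integrable hfact.out
  have hmem : ∀ g : Lp ℂ (ENNReal.ofReal s) (torusHaar d),
      MemLp (fun z : polydisc d => cauchyTorus g z) (ENNReal.ofReal s) μ := fun g =>
    hμ _ (memHardy_cauchyTorus hs (Lp.stronglyMeasurable g).measurable (hint g)
      ((memLp_ofReal_iff hs0).1 (Lp.memLp g)).2.ne)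
  let T : Lp ℂ (ENNReal.ofReal s) (torusHaar d) →ₗ[ℂ] Lp ℂ (ENNReal.ofReal s) μ :=
    { toFun := fun g => (hmem g).toLp _
      map_add' := fun g h => by
        rw [← MemLp.toLp_add]
        refine MemLp.toLp_congr _ _ (Filter.Eventually.of_forall fun z => ?_)
        simp only [Pi.add_apply]
        rw [cauchyTorus_congr_ae (Lp.coeFn_add g h), cauchyTorus_add z.2 (hint g) (hint h)]
      map_smul' := fun c g => by
        rw [RingHom.id_apply, ← MemLp.toLp_const_smul]
        refine MemLp.toLp_congr _ _ (Filter.Eventually.of_forall fun z => ?_)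
        simp only [Pi.smul_apply, smul_eq_mul]
        rw [cauchyTorus_congr_ae (Lp.coeFn_smul c g), cauchyTorus_smul] }
  have hT : ∀ g, T g =ᵐ[μ] fun z : polydisc d => cauchyTorus g z := fun g =>
    MemLp.coeFn_toLp (hmem g)
  have hcont : Continuous T := by
    -- A subsequence of `T (u n)` converges to `y` a.e., while `T (u n)` converges to `T x`
    -- pointwise because evaluations are continuous; so `y = T x`.
    refine T.continuous_of_seq_closed_graph fun u x y hu hTu => ?_
    obtain ⟨ns, hns, hae⟩ := (tendstoInMeasure_of_tendsto_Lp hTu).exists_seq_tendsto_ae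
    refine Lp.ext ?_
    have hall : ∀ᵐ z ∂μ, ∀ n, T (u n) z = cauchyTorus (u n) z :=
      ae_all_iff.2 fun n => hT (u n)
    filter_upwards [hae, hall, hT x] with z hz hz' hzx
    rw [hzx]
    refine tendsto_nhds_unique hz ?_
    simp only [Function.comp_apply, hz']
    obtain ⟨M, hM⟩ := exists_norm_cauchyTorus_le z.2 (ENNReal.ofReal s)
    have hlim : Filter.Tendsto (fun n => cauchyTorus (u n) z) Filter.atTop
        (nhds (cauchyTorus x z)) := by
      rw [tendsto_iff_norm_sub_tendsto_zero]
      have h0 : Filter.Tendsto (fun n => M * ‖u n - x‖) Filter.atTop (nhds 0) := by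
        simpa using (tendsto_iff_norm_sub_tendsto_zero.1 hu).const_mul M
      refine squeeze_zero (fun n => norm_nonneg _) (fun n => ?_) h0
      have h1 : cauchyTorus (u n) z = cauchyTorus (u n - x : Lp ℂ _ _) z + cauchyTorus x z := by
        rw [← cauchyTorus_add z.2 (hint _) (hint _), ← cauchyTorus_congr_ae (Lp.coeFn_add _ _),
          sub_add_cancel]
      rw [h1, add_sub_cancel_right]
      exact hM _
    exact hlim.comp hns.tendsto_atTop
  let L : Lp ℂ (ENNReal.ofReal s) (torusHaar d) →L[ℂ] Lp ℂ (ENNReal.ofReal s) μ := ⟨T, hcont⟩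
  -- The `+ 1` makes the constant nonzero, so the bound is trivial when the right-hand integral is
  -- `∞`.
  refine ⟨‖L‖ₑ ^ s + 1, ENNReal.add_ne_top.2
    ⟨ENNReal.rpow_ne_top_of_nonneg hs0.le enorm_ne_top, ENNReal.one_ne_top⟩, fun g hm hg => ?_⟩
  by_cases hfin : ∫⁻ θ, ‖g θ‖ₑ ^ s ∂(torusHaar d) = ∞
  · rw [hfin, ENNReal.mul_top (by simp)]
    exact le_top
  have hgL : MemLp g (ENNReal.ofReal s) (torusHaar d) :=
    (memLp_ofReal_iff hs0).2 ⟨hm.aestronglyMeasurable, lt_top_iff_ne_top.2 hfin⟩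
  have h1 : ‖T (hgL.toLp g)‖ₑ ≤ ‖L‖ₑ * ‖hgL.toLp g‖ₑ := L.le_opENorm _
  rw [Lp.enorm_def, Lp.enorm_def, eLpNorm_congr_ae hgL.coeFn_toLp,
    eLpNorm_congr_ae (hT (hgL.toLp g)), cauchyTorus_congr_ae hgL.coeFn_toLp] at h1
  rw [lintegral_enorm_rpow_eq_eLpNorm_rpow hs0 fun z : polydisc d => cauchyTorus g z,
    lintegral_enorm_rpow_eq_eLpNorm_rpow hs0]
  calc _ ≤ (‖L‖ₑ * eLpNorm g (ENNReal.ofReal s) (torusHaar d)) ^ s := by gcongr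
    _ = ‖L‖ₑ ^ s * eLpNorm g (ENNReal.ofReal s) (torusHaar d) ^ s :=
      ENNReal.mul_rpow_of_nonneg _ _ hs0.le
    _ ≤ _ := by gcongr; exact le_self_add

/-- `|f ^ n| ^ p = |f| ^ (n p)`, so the hypothesis is applied to `f ^ n`. -/
lemma IsCarlesonMeasure.nat_mul {d : ℕ} {p : ℝ} (hp : 0 < p) {μ : Measure (polydisc d)}
    (hμ : IsCarlesonMeasure p μ) {n : ℕ} (hn : 0 < n) : IsCarlesonMeasure (n * p) μ := by
  have hpow : ∀ w : ℂ, ‖w ^ n‖ₑ ^ p = ‖w‖ₑ ^ (n * p) := fun w => by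
    rw [enorm_pow, ← ENNReal.rpow_natCast, ← ENNReal.rpow_mul]
  intro f hf
  have hfn : MemHardy p fun z => f z ^ n := by
    refine ⟨hf.1.pow n, ?_⟩
    unfold hardyNormPow
    simp only [hpow]
    exact hf.2
  have h1 := ((memLp_ofReal_iff hp).1 (hμ _ hfn)).2
  simp only [hpow] at h1
  exact (memLp_ofReal_iff (by positivity)).2
    ⟨(continuous_restrict_polydisc hf.1).aestronglyMeasurable, h1⟩

/-- If the Cauchy integral is bounded from `L^q` of the torus to `L^q(μ)`, then `μ` is a Carleson
measure for `H^q`. -/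
lemma isCarlesonMeasure_of_lintegral_cauchyTorus_le {d : ℕ} {q : ℝ} (hq : 0 < q)
    {μ : Measure (polydisc d)} {C : ℝ≥0∞} (hC : C ≠ ∞)
    (h : ∀ g : UnitAddTorus (Fin d) → ℂ, Measurable g → Integrable g (torusHaar d) →
      ∫⁻ z : polydisc d, ‖cauchyTorus g z‖ₑ ^ q ∂μ ≤ C * ∫⁻ θ, ‖g θ‖ₑ ^ q ∂(torusHaar d)) :
    IsCarlesonMeasure q μ := by
  intro f hf
  have hfc := continuous_restrict_polydisc hf.1
  refine (memLp_ofReal_iff hq).2 ⟨hfc.aestronglyMeasurable, ?_⟩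
  have hmaps : ∀ r ∈ Set.Ioo (0 : ℝ) 1, Set.MapsTo (fun z : Fin d → ℂ => (r : ℂ) • z)
      {z | ∀ i, ‖z i‖ < r⁻¹} (polydisc d) := by
    intro r hr z hz i
    have h1 : r * ‖z i‖ < r * r⁻¹ := mul_lt_mul_of_pos_left (hz i) hr.1
    rw [mul_inv_cancel₀ hr.1.ne'] at h1
    simpa [abs_of_pos hr.1] using h1
  have hdiff : ∀ r ∈ Set.Ioo (0 : ℝ) 1,
      DifferentiableOn ℂ (fun z : Fin d → ℂ => f ((r : ℂ) • z)) {z | ∀ i, ‖z i‖ < r⁻¹} :=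
    fun r hr => hf.1.comp (differentiable_id.const_smul (r : ℂ)).differentiableOn (hmaps r hr)
  have hsub : ∀ r ∈ Set.Ioo (0 : ℝ) 1, polydisc d ⊆ {z | ∀ i, ‖z i‖ < r⁻¹} :=
    fun r hr z hz i => (hz i).trans ((one_lt_inv₀ hr.1).2 hr.2)
  -- The dilate is holomorphic on the polydisc of radius `1 / r > 1`, hence is the Cauchy integral
  -- of its values on the torus.
  have hbound : ∀ r ∈ Set.Ioo (0 : ℝ) 1,
      ∫⁻ z : polydisc d, ‖f ((r : ℂ) • (z : Fin d → ℂ))‖ₑ ^ q ∂μ ≤ C * hardyNormPow q f := by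
    intro r hr
    have hcont : Continuous fun θ : UnitAddTorus (Fin d) => f ((r : ℂ) • torusPoint θ) :=
      hf.1.continuousOn.comp_continuous (continuous_torusPoint.fun_const_smul (r : ℂ))
        (smul_torusPoint_mem_polydisc hr)
    have h1 := h _ hcont.measurable
      (hcont.integrable_of_hasCompactSupport (HasCompactSupport.of_compactSpace _))
    have h2 : ∀ z : polydisc d, cauchyTorus (fun θ => f ((r : ℂ) • torusPoint θ)) z =
        f ((r : ℂ) • (z : Fin d → ℂ)) := fun z =>
      cauchyTorus_comp_torusPoint (f := fun z => f ((r : ℂ) • z)) ((one_lt_inv₀ hr.1).2 hr.2)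
        (hdiff r hr) z.2
    simp only [h2] at h1
    refine h1.trans (mul_le_mul_right ?_ C)
    exact le_iSup₂ (f := fun (r : ℝ) (_ : r ∈ Set.Ioo (0 : ℝ) 1) =>
      ∫⁻ θ, ‖f ((r : ℂ) • torusPoint θ)‖ₑ ^ q ∂(torusHaar d)) r hr
  -- The shift by `2` makes `r 0 = 1/2` positive.
  let r : ℕ → ℝ := fun n => 1 - 1 / ((n : ℝ) + 2)
  have hr : ∀ n, r n ∈ Set.Ioo (0 : ℝ) 1 := fun n => by
    have h1 : (0 : ℝ) < n + 2 := by positivity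
    have h2 : 1 / ((n : ℝ) + 2) < 1 := by rw [div_lt_one h1]; linarith [n.cast_nonneg (α := ℝ)]
    have h3 : 0 < 1 / ((n : ℝ) + 2) := by positivity
    exact ⟨by simp only [r]; linarith, by simp only [r]; linarith⟩
  have hr1 : Filter.Tendsto r Filter.atTop (nhds 1) := by
    have h1 : Filter.Tendsto (fun n : ℕ => 1 / ((n : ℝ) + 2)) Filter.atTop (nhds 0) :=
      tendsto_const_nhds.div_atTop
        (Filter.tendsto_atTop_add_const_right _ _ tendsto_natCast_atTop_atTop)
    simpa [r] using h1.const_sub 1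
  have hopen : IsOpen (polydisc d) := by
    have h1 : polydisc d = ⋂ i, {z : Fin d → ℂ | ‖z i‖ < 1} := by
      ext z; simp [polydisc]
    rw [h1]
    exact isOpen_iInter_of_finite fun i =>
      isOpen_lt (continuous_apply i).norm continuous_const
  have hptw : ∀ z : polydisc d, Filter.Tendsto
      (fun n => ‖f ((r n : ℂ) • (z : Fin d → ℂ))‖ₑ ^ q) Filter.atTop (nhds (‖f z‖ₑ ^ q)) := by
    intro z
    have h1 : Filter.Tendsto (fun n => (r n : ℂ) • (z : Fin d → ℂ)) Filter.atTop
        (nhds (z : Fin d → ℂ)) := by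
      have h2 := ((Complex.continuous_ofReal.tendsto 1).comp hr1).smul_const (z : Fin d → ℂ)
      simpa using h2
    have h2 : ContinuousAt f z := hf.1.continuousOn.continuousAt (hopen.mem_nhds z.2)
    exact ((ENNReal.continuous_rpow_const.tendsto _).comp
      ((continuous_enorm.tendsto _).comp (h2.tendsto.comp h1)))
  have hmeas : ∀ n, Measurable fun z : polydisc d =>
      ‖f ((r n : ℂ) • (z : Fin d → ℂ))‖ₑ ^ q := fun n =>
    (continuous_restrict_polydisc ((hdiff _ (hr n)).mono (hsub _ (hr n)))).measurable.enorm.pow_const q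
  -- Fatou's lemma along the radii `r n → 1`.
  calc ∫⁻ z : polydisc d, ‖f z‖ₑ ^ q ∂μ
      = ∫⁻ z : polydisc d, Filter.liminf
          (fun n => ‖f ((r n : ℂ) • (z : Fin d → ℂ))‖ₑ ^ q) Filter.atTop ∂μ :=
        lintegral_congr fun z => (hptw z).liminf_eq.symm
    _ ≤ Filter.liminf (fun n => ∫⁻ z : polydisc d,
          ‖f ((r n : ℂ) • (z : Fin d → ℂ))‖ₑ ^ q ∂μ) Filter.atTop := lintegral_liminf_le hmeas
    _ ≤ C * hardyNormPow q f := by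
        refine Filter.liminf_le_of_frequently_le' (Filter.Frequently.of_forall fun n => ?_)
        exact hbound _ (hr n)
    _ < ∞ := ENNReal.mul_lt_top hC.lt_top hf.2

theorem lemma3p3 (d : ℕ) (p q : ℝ) (hp : 1 < p) (hpq : p < q) (μ : Measure (polydisc d))
    (hμ : IsCarlesonMeasure p μ) : IsCarlesonMeasure q μ := by
  have hp0 : 0 < p := by linarith
  -- Any `n > q / p` places `q` strictly between the endpoints `p` and `n p`.
  obtain ⟨n, hn⟩ := exists_nat_gt (q / p)
  have hqn : q < n * p := (div_lt_iff₀ hp0).1 hn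
  have hn0 : 0 < n := by
    have : (0 : ℝ) < n := (div_pos (hp0.trans hpq) hp0).trans hn
    exact_mod_cast this
  obtain ⟨A, hA, hA'⟩ := hμ.exists_lintegral_cauchyTorus_le hp
  obtain ⟨B, hB, hB'⟩ := (hμ.nat_mul hp0 hn0).exists_lintegral_cauchyTorus_le
    (hp.trans (hpq.trans hqn))
  let T : (UnitAddTorus (Fin d) → ℂ) → polydisc d → ℂ := fun g z => cauchyTorus g z
  have hadd : ∀ g h : UnitAddTorus (Fin d) → ℂ, Measurable g → Measurable h →
      Integrable g (torusHaar d) → Integrable h (torusHaar d) →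
      ∀ z, ‖T (g + h) z‖ ≤ ‖T g z‖ + ‖T h z‖ := by
    intro g h _ _ hg hh z
    simp only [T]
    rw [cauchyTorus_add z.2 hg hh]
    exact norm_add_le _ _
  have hmeas : ∀ g : UnitAddTorus (Fin d) → ℂ, Measurable g → Integrable g (torusHaar d) →
      AEMeasurable (T g) μ := fun g _ hg =>
    (continuous_restrict_polydisc (differentiableOn_cauchyTorus hg)).measurable.aemeasurable
  refine isCarlesonMeasure_of_lintegral_cauchyTorus_le (hp0.trans hpq)
    (C := ENNReal.ofReal q * (ENNReal.ofReal (2 ^ p) * A * ENNReal.ofReal (1 / (q - p)) +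
      ENNReal.ofReal (2 ^ (n * p)) * B * ENNReal.ofReal (1 / (n * p - q)))) (by finiteness)
    fun g hm hg => ?_
  exact lintegral_enorm_rpow_le_of_strong_type T hp0 hpq hqn hadd hmeas hA' hB' hm hg
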